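/- Let $E\in C^2(\mathbb R^d;\mathbb R)$, $F=-\nabla E$, $J=-\nabla^2E$, and let $\|\cdot\|$ be the Euclidean norm of vectors and the induced $\ell^2$ operator norm of matrices. Assume (Assumption A) that $F(x)=\mathcal Lx+\mathcal N(x)$ with $\mathcal L$ linear and that there is $L>0$ such that for all $x,x_1,x_2\in\mathbb R^d$ $$\max\{\|J(x_2)-J(x_1)\|,\|\mathcal Lx_2-\mathcal Lx_1\|,\|\mathcal N(x_2)-\mathcal N(x_1)\|\}\le L\|x_2-x_1\|,\qquad \max\{\|\mathcal Lx\|,\|\mathcal N(x)\|\}\le L(1+\|x\|).$$ Let $x_0\in S^{d-1}$ and let $v_{1,0},\dots,v_{k,0}$ be orthonormal vectors orthogonal to $x_0$. Let $T>0$ and let $x(t),v_1(t),\dots,v_k(t)$ solve on $[0,T]$ the sphere-constrained high-index saddle dynamics $$\dot x=\Big(I-xx^\top-2\sum_{j=1}^kv_jv_j^\top\Big)F(x),\qquad \dot v_i=\Big(I-xx^\top-v_iv_i^\top-2\sum_{j=1}^{i-1}v_jv_j^\top\Big)J(x)v_i+x\,v_i^\top F(x)\quad(1\le i\le k),$$ with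 $x(0)=x_0$, $v_i(0)=v_{i,0}$. For an integer $N\ge1$ put $\tau=T/N$, $t_n=n\tau$, and consider the semi-implicit scheme, for $1\le n\le N$, started from $x_0,v_{i,0}$: $$\tilde x_n=x_{n-1}+\tau\Big(I-2\sum_{j=1}^kv_{j,n-1}v_{j,n-1}^\top\Big)(\mathcal L\tilde x_n+\mathcal N(x_{n-1}))-\tau x_{n-1}x_{n-1}^\top(\mathcal Lx_{n-1}+\mathcal N(x_{n-1})),\qquad x_n=\frac{\tilde x_n}{\|\tilde x_n\|},$$ and, successively for $i=1,\dots,k$, $$\tilde v_{i,n}=v_{i,n-1}+\tau\Big(I-x_nx_n^\top-2\sum_{j=1}^{i-1}v_{j,n}v_{j,n}^\top\Big)J(x_n)\tilde v_{i,n}-\tau v_{i,n-1}v_{i,n-1}^\top J(x_n)v_{i,n-1}+\tau x_n\tilde v_{i,n}^\top F(x_n),$$ $$\hat v_{i,n}=\tilde v_{i,n}-(\tilde v_{i,n}^\top x_n)x_n,\qquad v_{i,n}=\frac{w_{i,n}}{\|w_{i,n}\|},\quad w_{i,n}=\hat v_{i,n}-\sum_{j=1}^{i-1}(\hat v_{i,n}^\top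 v_{j,n})v_{j,n}.$$ Then there are constants $\tau_0>0$ and $Q>0$, independent of $\tau$, $n$ and $N$, such that for every $N\ge1$ with $\tau=T/N\le\tau_0$ the scheme has a solution, and every solution of the scheme satisfies $\tilde x_n\ne0$ and $w_{i,n}\ne0$ for all $1\le n\le N$, $1\le i\le k$ (so that all normalizations are well defined) and $$\max_{1\le n\le N}\{\|x(t_n)-x_n\|,\|v_1(t_n)-v_{1,n}\|,\dots,\|v_k(t_n)-v_{k,n}\|\}\le Q\tau .$$ -/

import Mathlib

open scoped InnerProductSpace
open Finset

/-- The force `F(x) = -∇E(x)`. -/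
noncomputable def saddleForce {d : ℕ} (E : EuclideanSpace ℝ (Fin d) → ℝ)
    (x : EuclideanSpace ℝ (Fin d)) : EuclideanSpace ℝ (Fin d) :=
  -gradient E x

/-- The negative Hessian `J(x) = -∇²E(x)`, as a linear operator (its norm is the `l²` operator
norm). -/
noncomputable def saddleJ {d : ℕ} (E : EuclideanSpace ℝ (Fin d) → ℝ)
    (x : EuclideanSpace ℝ (Fin d)) :
    EuclideanSpace ℝ (Fin d) →L[ℝ] EuclideanSpace ℝ (Fin d) :=
  -fderiv ℝ (gradient E) x

/-- The splitting `F(x) = 𝓛 x + 𝓝(x)` of the force into a linear and a nonlinear part, with the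
Lipschitz and linear growth conditions with constant `L > 0`. -/
structure ForceSplitting {d : ℕ} (E : EuclideanSpace ℝ (Fin d) → ℝ)
    (Lin : EuclideanSpace ℝ (Fin d) →ₗ[ℝ] EuclideanSpace ℝ (Fin d))
    (Non : EuclideanSpace ℝ (Fin d) → EuclideanSpace ℝ (Fin d)) (L : ℝ) : Prop where
  pos : 0 < L
  split : ∀ x, saddleForce E x = Lin x + Non x
  lipschitz : ∀ x₁ x₂,
    max ‖saddleJ E x₂ - saddleJ E x₁‖ (max ‖Lin x₂ - Lin x₁‖ ‖Non x₂ - Non x₁‖) ≤ L * ‖x₂ - x₁‖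
  growth : ∀ x, max ‖Lin x‖ ‖Non x‖ ≤ L * (1 + ‖x‖)

/-- Admissible initial data: `x₀` on the unit sphere, `v₀` orthonormal and tangent at `x₀`. -/
structure SaddleInitialData {d k : ℕ} (x₀ : EuclideanSpace ℝ (Fin d))
    (v₀ : Fin k → EuclideanSpace ℝ (Fin d)) : Prop where
  norm_eq : ‖x₀‖ = 1
  orthonormal : Orthonormal ℝ v₀
  tangent : ∀ i, ⟪x₀, v₀ i⟫_ℝ = 0

/-- `(x, v₁, …, v_k)` solves, on `[0, T]`, the sphere-constrained high-index saddle dynamics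
with initial value `(x₀, v₀)`. Here `(a aᵀ) w` is written `⟪a, w⟫ • a`. -/
structure IsSaddleDynamics {d k : ℕ} (E : EuclideanSpace ℝ (Fin d) → ℝ) (T : ℝ)
    (x₀ : EuclideanSpace ℝ (Fin d)) (v₀ : Fin k → EuclideanSpace ℝ (Fin d))
    (x : ℝ → EuclideanSpace ℝ (Fin d)) (v : Fin k → ℝ → EuclideanSpace ℝ (Fin d)) : Prop where
  x_init : x 0 = x₀
  v_init : ∀ i, v i 0 = v₀ i
  x_deriv : ∀ t ∈ Set.Icc 0 T, HasDerivWithinAt x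
    (saddleForce E (x t) - ⟪x t, saddleForce E (x t)⟫_ℝ • x t
      - (2 : ℝ) • ∑ j, ⟪v j t, saddleForce E (x t)⟫_ℝ • v j t)
    (Set.Icc 0 T) t
  v_deriv : ∀ i, ∀ t ∈ Set.Icc 0 T, HasDerivWithinAt (v i)
    (saddleJ E (x t) (v i t) - ⟪x t, saddleJ E (x t) (v i t)⟫_ℝ • x t
      - ⟪v i t, saddleJ E (x t) (v i t)⟫_ℝ • v i t
      - (2 : ℝ) • ∑ j ∈ Iio i, ⟪v j t, saddleJ E (x t) (v i t)⟫_ℝ • v j t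
      + ⟪v i t, saddleForce E (x t)⟫_ℝ • x t)
    (Set.Icc 0 T) t

/-- The unnormalized Gram–Schmidt vector `w - ∑_{j < i} (wᵀ u_j) u_j`; its norm is the
normalization factor. -/
noncomputable def gsResidual {d k : ℕ} (w : EuclideanSpace ℝ (Fin d))
    (u : Fin k → EuclideanSpace ℝ (Fin d)) (i : Fin k) : EuclideanSpace ℝ (Fin d) :=
  w - ∑ j ∈ Iio i, ⟪w, u j⟫_ℝ • u j

/-- All the quantities computed by the scheme: `xt n = x̃_n`, `x n = x_n`, `vt n i = ṽ_{i,n}`,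
`vh n i = v̂_{i,n}`, `v n i = v_{i,n}`. -/
structure SchemeData (d k : ℕ) where
  xt : ℕ → EuclideanSpace ℝ (Fin d)
  x : ℕ → EuclideanSpace ℝ (Fin d)
  vt : ℕ → Fin k → EuclideanSpace ℝ (Fin d)
  vh : ℕ → Fin k → EuclideanSpace ℝ (Fin d)
  v : ℕ → Fin k → EuclideanSpace ℝ (Fin d)

/-- `S` satisfies the first `N` steps of the semi-implicit scheme with step size `τ`: a
semi-implicit Euler step and retraction for `x`, then sequentially in `i` a semi-implicit Euler
step, vector transport and Gram–Schmidt normalization for `v_i`. -/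
structure IsSemiImplicitScheme {d k : ℕ} (E : EuclideanSpace ℝ (Fin d) → ℝ)
    (Lin : EuclideanSpace ℝ (Fin d) →ₗ[ℝ] EuclideanSpace ℝ (Fin d))
    (Non : EuclideanSpace ℝ (Fin d) → EuclideanSpace ℝ (Fin d))
    (x₀ : EuclideanSpace ℝ (Fin d)) (v₀ : Fin k → EuclideanSpace ℝ (Fin d))
    (τ : ℝ) (N : ℕ) (S : SchemeData d k) : Prop where
  x_init : S.x 0 = x₀
  v_init : S.v 0 = v₀
  x_step : ∀ n, 1 ≤ n → n ≤ N →
    S.xt n = S.x (n - 1)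
      + τ • ((Lin (S.xt n) + Non (S.x (n - 1)))
        - (2 : ℝ) • ∑ j, ⟪S.v (n - 1) j, Lin (S.xt n) + Non (S.x (n - 1))⟫_ℝ • S.v (n - 1) j)
      - τ • (⟪S.x (n - 1), Lin (S.x (n - 1)) + Non (S.x (n - 1))⟫_ℝ • S.x (n - 1))
  retraction : ∀ n, 1 ≤ n → n ≤ N → S.x n = ‖S.xt n‖⁻¹ • S.xt n
  v_step : ∀ n, 1 ≤ n → n ≤ N → ∀ i,
    S.vt n i = S.v (n - 1) i
      + τ • (saddleJ E (S.x n) (S.vt n i)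
        - ⟪S.x n, saddleJ E (S.x n) (S.vt n i)⟫_ℝ • S.x n
        - (2 : ℝ) • ∑ j ∈ Iio i, ⟪S.v n j, saddleJ E (S.x n) (S.vt n i)⟫_ℝ • S.v n j)
      - τ • (⟪S.v (n - 1) i, saddleJ E (S.x n) (S.v (n - 1) i)⟫_ℝ • S.v (n - 1) i)
      + τ • (⟪S.vt n i, saddleForce E (S.x n)⟫_ℝ • S.x n)
  transport : ∀ n, 1 ≤ n → n ≤ N → ∀ i, S.vh n i = S.vt n i - ⟪S.vt n i, S.x n⟫_ℝ • S.x n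
  gram_schmidt : ∀ n, 1 ≤ n → n ≤ N → ∀ i,
    S.v n i = ‖gsResidual (S.vh n i) (S.v n) i‖⁻¹ • gsResidual (S.vh n i) (S.v n) i

/-- No division by zero occurs in the retraction and the Gram–Schmidt step. -/
def SchemeNondegenerate {d k : ℕ} (N : ℕ) (S : SchemeData d k) : Prop :=
  ∀ n, 1 ≤ n → n ≤ N → S.xt n ≠ 0 ∧ ∀ i, gsResidual (S.vh n i) (S.v n) i ≠ 0

/-!
The scheme has order one because it is, up to `O(τ²)` per step, the explicit Euler method for the
saddle dynamics, viewed as an autonomous system `u' = G u` for `u = (x, v₁, …, v_k)`.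

*Consistency.* The iterates lie exactly on the manifold of positions on the unit sphere with an
orthonormal tangent frame. There `G` is tangent to the manifold: to the sphere
(`inner_positionField_self`), and to the constraints on the frame
(`inner_directionField_position`, `inner_directionField_self`, `inner_directionField_of_lt`, the
last one by symmetry of the Hessian). The semi-implicit solves agree with the Euler step
`u + τ G u` up to `O(τ²)` (`xt_congrMod`, `vt_congrMod`). By tangency, the Euler step satisfies all
the constraints up to `O(τ²)` (`CongrMod.inner_of_cancel`), so that retraction, vector transport and
Gram–Schmidt divide by `1 + O(τ²)` and move the vectors by `O(τ²)` only (`position_step`,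
`direction_step`, the latter by induction on the index of the direction). In particular no
division by zero occurs, and the next iterate is on the manifold again.

*Uniformity.* All these estimates are `IsBigO` statements along the filter `comap τ (𝓝 0)` on the
type of all single steps of the scheme, so their constants do not depend on the step;
`exists_uniform_step` unfolds them.

*Convergence.* Only boundedness of the exact solution is needed, not that it stays on the
manifold. On a ball containing the exact solution and the iterates, `G` is Lipschitz, being a
polynomial in `x`, `v`, the force and the Hessian (`locallyLipschitz_saddleField`), and the error
bound follows from the discrete Gronwall inequality (`euler_convergence`).

*Solvability.* Each implicit equation has the form `y = b + A y`, where `‖A‖ < 1` for small `τ`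
because all the vectors involved have norm at most one (`exists_schemeStep`).
-/

open Filter Asymptotics Topology

/-! ### Congruence modulo powers of the step size -/

section Congruence

variable {Ω : Type*} {l : Filter Ω} {τ : Ω → ℝ}
variable {V W X Y Z : Type*}
  [NormedAddCommGroup V] [InnerProductSpace ℝ V]
  [NormedAddCommGroup W] [NormedAddCommGroup X] [NormedAddCommGroup Y] [NormedAddCommGroup Z]

theorem norm_inv_norm_smul {V : Type*} [NormedAddCommGroup V] [NormedSpace ℝ V] {w : V}
    (hw : w ≠ 0) : ‖‖w‖⁻¹ • w‖ = 1 := by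
  rw [norm_smul, norm_inv, norm_norm, inv_mul_cancel₀ (norm_ne_zero_iff.2 hw)]

/-- `f` and `g` agree up to an error `O(τ ^ p)` along the filter `l`. -/
def CongrMod (l : Filter Ω) (τ : Ω → ℝ) (p : ℕ) (f g : Ω → W) : Prop :=
  (fun ω => f ω - g ω) =O[l] fun ω => τ ω ^ p

/-- `f` is bounded along the filter `l`. -/
def BoundedAlong (l : Filter Ω) (f : Ω → W) : Prop :=
  f =O[l] fun _ => (1 : ℝ)

namespace CongrMod

variable {p : ℕ} {f f' g g' h : Ω → W}

theorem refl (f : Ω → W) : CongrMod l τ p f f := by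
  simpa [CongrMod] using isBigO_zero _ _

theorem of_eventuallyEq (h : f =ᶠ[l] g) : CongrMod l τ p f g := by
  refine (isBigO_zero (E' := W) (fun ω => τ ω ^ p) l).congr' ?_ EventuallyEq.rfl
  filter_upwards [h] with ω hω
  simp [hω]

theorem trans (h₁ : CongrMod l τ p f g) (h₂ : CongrMod l τ p g h) : CongrMod l τ p f h := by
  have := IsBigO.add h₁ h₂
  simpa [CongrMod] using this

theorem add (h₁ : CongrMod l τ p f g) (h₂ : CongrMod l τ p f' g') :
    CongrMod l τ p (fun ω => f ω + f' ω) (fun ω => g ω + g' ω) := by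
  have := IsBigO.add h₁ h₂
  exact this.congr_left fun ω => sub_add_sub_comm _ _ _ _

theorem sub (h₁ : CongrMod l τ p f g) (h₂ : CongrMod l τ p f' g') :
    CongrMod l τ p (fun ω => f ω - f' ω) (fun ω => g ω - g' ω) := by
  have := IsBigO.sub h₁ h₂
  exact this.congr_left fun ω => sub_sub_sub_comm _ _ _ _

theorem const_smul [NormedSpace ℝ W] (c : ℝ) (h : CongrMod l τ p f g) :
    CongrMod l τ p (fun ω => c • f ω) (fun ω => c • g ω) := by
  have := IsBigO.const_smul_left h c
  refine this.congr_left fun ω => ?_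
  simp [smul_sub]

theorem sum {ι : Type*} {s : Finset ι} {f g : ι → Ω → W}
    (h : ∀ i ∈ s, CongrMod l τ p (f i) (g i)) :
    CongrMod l τ p (fun ω => ∑ i ∈ s, f i ω) (fun ω => ∑ i ∈ s, g i ω) := by
  have := IsBigO.sum (g := fun ω => τ ω ^ p) h
  refine this.congr_left fun ω => ?_
  simp

theorem step_smul [NormedSpace ℝ W] (h : CongrMod l τ p f g) :
    CongrMod l τ (p + 1) (fun ω => τ ω • f ω) (fun ω => τ ω • g ω) := by
  have := IsBigO.smul (isBigO_refl τ l) h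
  refine this.congr (fun ω => ?_) (fun ω => ?_)
  · simp [smul_sub]
  · simp [pow_succ, mul_comm]

theorem of_le {q : ℕ} (hτ : Tendsto τ l (𝓝 0)) (hpq : q ≤ p) (h : CongrMod l τ p f g) :
    CongrMod l τ q f g := by
  refine IsBigO.trans h ?_
  have h1 : τ =O[l] fun _ => (1 : ℝ) := hτ.isBigO_one ℝ
  have h2 := (isBigO_refl (fun ω => τ ω ^ q) l).mul (h1.pow (p - q))
  refine h2.congr (fun ω => ?_) (fun ω => by simp)
  rw [← pow_add]; congr 1; omega

end CongrMod

namespace BoundedAlong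

variable {p : ℕ} {f g : Ω → W}

theorem of_norm_le (C : ℝ) (h : ∀ᶠ ω in l, ‖f ω‖ ≤ C) : BoundedAlong l f :=
  IsBigO.of_bound C (by simpa using h)

theorem congr (hτ : Tendsto τ l (𝓝 0)) (hg : BoundedAlong l g) (h : CongrMod l τ p f g) :
    BoundedAlong l f := by
  have h1 : CongrMod l τ 0 f g := h.of_le hτ (Nat.zero_le _)
  have h2 : (fun ω => f ω - g ω) =O[l] fun _ => (1 : ℝ) := by simpa [CongrMod] using h1
  refine (IsBigO.add h2 hg).congr_left fun ω => ?_
  simp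

theorem bilin [NormedSpace ℝ X] [NormedSpace ℝ Y] [NormedSpace ℝ Z]
    (B : X →L[ℝ] Y →L[ℝ] Z) {a : Ω → X} {b : Ω → Y} {u w : Ω → ℝ}
    (ha : a =O[l] u) (hb : b =O[l] w) :
    (fun ω => B (a ω) (b ω)) =O[l] fun ω => u ω * w ω := by
  have h1 : (fun ω => B (a ω) (b ω)) =O[l] fun ω => ‖a ω‖ * ‖b ω‖ :=
    IsBigO.of_bound ‖B‖ (Eventually.of_forall fun ω => by
      simpa [mul_assoc] using B.le_opNorm₂ (a ω) (b ω))
  exact h1.trans (ha.norm_left.mul hb.norm_left)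

/-- Applying `f ↦ ⟪a, f⟫ • b` with bounded `a` and `b` does not enlarge the order of growth. -/
theorem inner_smul_isBigO {a b f : Ω → V} {u : Ω → ℝ} (ha : BoundedAlong l a)
    (hb : BoundedAlong l b) (hf : f =O[l] u) : (fun ω => ⟪a ω, f ω⟫_ℝ • b ω) =O[l] u := by
  have h1 := bilin (innerSL ℝ) ha hf
  have h2 := h1.smul hb
  exact h2.congr (fun _ => rfl) (fun ω => by simp)

theorem const_smul_sum_inner_smul_isBigO {ι : Type*} {s : Finset ι} (c : ℝ) {a : Ω → ι → V}
    {f : Ω → V} {u : Ω → ℝ} (ha : ∀ i ∈ s, BoundedAlong l fun ω => a ω i) (hf : f =O[l] u) :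
    (fun ω => c • ∑ i ∈ s, ⟪a ω i, f ω⟫_ℝ • a ω i) =O[l] u := by
  have h1 : (fun ω => ∑ i ∈ s, ⟪a ω i, f ω⟫_ℝ • a ω i) =O[l] u := by
    have h := IsBigO.sum (g := u) fun i hi => inner_smul_isBigO (ha i hi) (ha i hi) hf
    exact h.congr_left fun ω => Finset.sum_apply _ _ _
  have h2 := IsBigO.const_smul_left h1 c
  exact h2.congr_left fun ω => rfl

end BoundedAlong

namespace CongrMod

variable {p : ℕ}

theorem bilin [NormedSpace ℝ X] [NormedSpace ℝ Y] [NormedSpace ℝ Z]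
    (hτ : Tendsto τ l (𝓝 0)) (B : X →L[ℝ] Y →L[ℝ] Z) {a a' : Ω → X} {b b' : Ω → Y}
    (ha : CongrMod l τ p a a') (hb : CongrMod l τ p b b')
    (ha' : BoundedAlong l a') (hb' : BoundedAlong l b') :
    CongrMod l τ p (fun ω => B (a ω) (b ω)) (fun ω => B (a' ω) (b' ω)) := by
  have h1 := BoundedAlong.bilin B ha (hb'.congr hτ hb)
  have h2 := BoundedAlong.bilin B ha' hb
  simp only [mul_one, one_mul] at h1 h2
  refine (h1.add h2).congr_left fun ω => ?_
  simp

theorem inner (hτ : Tendsto τ l (𝓝 0)) {a a' b b' : Ω → V}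
    (ha : CongrMod l τ p a a') (hb : CongrMod l τ p b b')
    (ha' : BoundedAlong l a') (hb' : BoundedAlong l b') :
    CongrMod l τ p (fun ω => ⟪a ω, b ω⟫_ℝ) (fun ω => ⟪a' ω, b' ω⟫_ℝ) :=
  bilin hτ (innerSL ℝ) ha hb ha' hb'

theorem apply [NormedSpace ℝ X] [NormedSpace ℝ Y] (hτ : Tendsto τ l (𝓝 0))
    {a a' : Ω → X →L[ℝ] Y} {b b' : Ω → X}
    (ha : CongrMod l τ p a a') (hb : CongrMod l τ p b b')
    (ha' : BoundedAlong l a') (hb' : BoundedAlong l b') :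
    CongrMod l τ p (fun ω => a ω (b ω)) (fun ω => a' ω (b' ω)) :=
  bilin hτ (ContinuousLinearMap.id ℝ (X →L[ℝ] Y)) ha hb ha' hb'

theorem inner_smul (hτ : Tendsto τ l (𝓝 0)) {a a' b b' f f' : Ω → V}
    (ha : CongrMod l τ p a a') (hf : CongrMod l τ p f f') (hb : CongrMod l τ p b b')
    (ha' : BoundedAlong l a') (hf' : BoundedAlong l f') (hb' : BoundedAlong l b') :
    CongrMod l τ p (fun ω => ⟪a ω, f ω⟫_ℝ • b ω) (fun ω => ⟪a' ω, f' ω⟫_ℝ • b' ω) := by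
  have h1 := ha.inner hτ hf ha' hf'
  have h2 : BoundedAlong l fun ω => ⟪a' ω, f' ω⟫_ℝ := by
    have := BoundedAlong.bilin (innerSL ℝ) ha' hf'
    exact this.congr (fun _ => rfl) (fun _ => one_mul 1)
  exact bilin hτ (ContinuousLinearMap.lsmul ℝ ℝ) h1 hb h2 hb'

theorem const_smul_sum_inner_smul (hτ : Tendsto τ l (𝓝 0)) {ι : Type*} {s : Finset ι} (c : ℝ)
    {a a' : Ω → ι → V} {f f' : Ω → V}
    (ha : ∀ i ∈ s, CongrMod l τ p (fun ω => a ω i) fun ω => a' ω i) (hf : CongrMod l τ p f f')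
    (ha' : ∀ i ∈ s, BoundedAlong l fun ω => a' ω i) (hf' : BoundedAlong l f') :
    CongrMod l τ p (fun ω => c • ∑ i ∈ s, ⟪a ω i, f ω⟫_ℝ • a ω i)
      fun ω => c • ∑ i ∈ s, ⟪a' ω i, f' ω⟫_ℝ • a' ω i :=
  const_smul c (sum fun i hi =>
    (ha i hi).inner_smul hτ hf (ha i hi) (ha' i hi) hf' (ha' i hi))

/-- A Lipschitz map preserves congruence. -/
theorem lipschitz {φ : X → Y} {C : ℝ} (hφ : ∀ a b, ‖φ b - φ a‖ ≤ C * ‖b - a‖) {a b : Ω → X}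
    (h : CongrMod l τ p a b) : CongrMod l τ p (fun ω => φ (a ω)) (fun ω => φ (b ω)) :=
  IsBigO.trans (IsBigO.of_bound C (Eventually.of_forall fun ω => hφ (b ω) (a ω))) h

/-- The inner product of two first-order expansions whose first-order term cancels is constant
up to `O(τ²)`. -/
theorem inner_of_cancel (hτ : Tendsto τ l (𝓝 0)) {a a₀ a₁ b b₀ b₁ : Ω → V} {c : ℝ}
    (ha : CongrMod l τ 2 a fun ω => a₀ ω + τ ω • a₁ ω)
    (hb : CongrMod l τ 2 b fun ω => b₀ ω + τ ω • b₁ ω)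
    (ha₀ : BoundedAlong l a₀) (ha₁ : BoundedAlong l a₁)
    (hb₀ : BoundedAlong l b₀) (hb₁ : BoundedAlong l b₁)
    (h₀ : ∀ ω, ⟪a₀ ω, b₀ ω⟫_ℝ = c) (h₁ : ∀ ω, ⟪a₁ ω, b₀ ω⟫_ℝ + ⟪a₀ ω, b₁ ω⟫_ℝ = 0) :
    CongrMod l τ 2 (fun ω => ⟪a ω, b ω⟫_ℝ) fun _ => c := by
  have bd : ∀ {y₀ y₁ : Ω → V}, BoundedAlong l y₀ → BoundedAlong l y₁ →
      BoundedAlong l fun ω => y₀ ω + τ ω • y₁ ω := fun h h' => by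
    have h1 := (hτ.isBigO_one ℝ).smul h'
    simp only [smul_eq_mul, mul_one] at h1
    exact IsBigO.add h h1
  refine (ha.inner hτ hb (bd ha₀ ha₁) (bd hb₀ hb₁)).trans ?_
  have h2 := BoundedAlong.bilin (innerSL ℝ) ha₁ hb₁
  have h3 := (isBigO_refl (fun ω => τ ω ^ 2) l).mul h2
  refine h3.congr (fun ω => ?_) (fun ω => by simp)
  have e0 := h₀ ω
  have e1 := h₁ ω
  have e2 : innerSL ℝ (a₁ ω) (b₁ ω) = ⟪a₁ ω, b₁ ω⟫_ℝ := rfl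
  rw [e2]
  simp only [inner_add_left, inner_add_right, inner_smul_left,
    inner_smul_right, RCLike.conj_to_real]
  linear_combination (-1) * e0 - τ ω * e1

/-- A vector whose squared length is `1 + O(τ²)` is eventually nonzero, and normalizing it
changes it by `O(τ²)` only. -/
theorem normalize (hτ : Tendsto τ l (𝓝 0)) {w : Ω → V}
    (h : CongrMod l τ 2 (fun ω => ⟪w ω, w ω⟫_ℝ) fun _ => (1 : ℝ)) :
    (∀ᶠ ω in l, w ω ≠ 0) ∧ CongrMod l τ 2 (fun ω => ‖w ω‖⁻¹ • w ω) w := by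
  have hne : ∀ᶠ ω in l, w ω ≠ 0 := by
    have h1 : Tendsto (fun ω => ⟪w ω, w ω⟫_ℝ - 1) l (𝓝 0) := by
      refine IsBigO.trans_tendsto h ?_
      simpa using hτ.pow 2
    filter_upwards [h1.eventually (gt_mem_nhds (show (0 : ℝ) < 1 by norm_num)),
      h1.eventually (lt_mem_nhds (show (-1 : ℝ) < 0 by norm_num))] with ω _ h3 h0
    simp [h0] at h3
  refine ⟨hne, IsBigO.trans (IsBigO.of_bound 1 ?_) h⟩
  filter_upwards [hne] with ω hω
  have hpos : 0 < ‖w ω‖ := norm_pos_iff.2 hω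
  have e : ‖w ω‖⁻¹ • w ω - w ω = (‖w ω‖⁻¹ - 1) • w ω := by simp [sub_smul]
  rw [e, norm_smul, real_inner_self_eq_norm_sq, one_mul, Real.norm_eq_abs, Real.norm_eq_abs]
  have e2 : |‖w ω‖⁻¹ - 1| * ‖w ω‖ = |1 - ‖w ω‖| := by
    rw [← abs_of_pos hpos, ← abs_mul, abs_of_pos hpos]
    congr 1
    field_simp
  have e3 : ‖w ω‖ ^ 2 - 1 = -((1 - ‖w ω‖) * (1 + ‖w ω‖)) := by ring
  rw [e2, e3, abs_neg, abs_mul]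
  have : 1 ≤ |1 + ‖w ω‖| := by rw [abs_of_pos (by positivity)]; linarith
  nlinarith [abs_nonneg (1 - ‖w ω‖)]

/-- A-priori bound for an implicit step: an increment `O(τ (‖y‖ + 1))` is in fact `O(τ)`. -/
theorem of_implicit (hτ : Tendsto τ l (𝓝 0)) {y y₀ : Ω → W} (hy₀ : BoundedAlong l y₀)
    (h : (fun ω => y ω - y₀ ω) =O[l] fun ω => τ ω * (‖y ω‖ + 1)) :
    CongrMod l τ 1 y y₀ := by
  obtain ⟨C, hC, hb⟩ := h.exists_pos
  obtain ⟨D, hD, hd⟩ := hy₀.exists_pos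
  rw [IsBigOWith] at hb hd
  have hs : ∀ᶠ ω in l, C * |τ ω| < 1 / 2 := by
    have h1 : Tendsto (fun ω => C * |τ ω|) l (𝓝 0) := by simpa using (hτ.abs).const_mul C
    exact h1.eventually (gt_mem_nhds (by norm_num))
  have hy : BoundedAlong l y := by
    refine BoundedAlong.of_norm_le (2 * D + 1) ?_
    filter_upwards [hb, hd, hs] with ω h1 h2 h3
    rw [norm_mul, Real.norm_eq_abs, Real.norm_of_nonneg (by positivity)] at h1
    simp only [norm_one, mul_one] at h2
    have h4 := norm_le_norm_add_norm_sub' (y ω) (y₀ ω)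
    nlinarith [norm_nonneg (y ω)]
  have h5 : (fun ω => ‖y ω‖ + 1) =O[l] fun _ => (1 : ℝ) :=
    hy.norm_left.add (isBigO_refl _ _)
  have h6 := h.trans ((isBigO_refl τ l).mul h5)
  exact h6.congr_right fun ω => by simp

end CongrMod

end Congruence

/-! ### The force and the Hessian -/

section Force

/-- `d`-dimensional Euclidean space. -/
abbrev Euc (d : ℕ) := EuclideanSpace ℝ (Fin d)

variable {d k : ℕ} {E : Euc d → ℝ} {Lin : Euc d →ₗ[ℝ] Euc d} {Non : Euc d → Euc d} {L : ℝ}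

theorem ForceSplitting.lin_lipschitz (hF : ForceSplitting E Lin Non L) (a b : Euc d) :
    ‖Lin b - Lin a‖ ≤ L * ‖b - a‖ :=
  (le_max_left _ _).trans ((le_max_right _ _).trans (hF.lipschitz a b))

theorem ForceSplitting.non_lipschitz (hF : ForceSplitting E Lin Non L) (a b : Euc d) :
    ‖Non b - Non a‖ ≤ L * ‖b - a‖ :=
  (le_max_right _ _).trans ((le_max_right _ _).trans (hF.lipschitz a b))

theorem ForceSplitting.saddleJ_lipschitz (hF : ForceSplitting E Lin Non L) (a b : Euc d) :
    ‖saddleJ E b - saddleJ E a‖ ≤ L * ‖b - a‖ :=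
  (le_max_left _ _).trans (hF.lipschitz a b)

theorem ForceSplitting.saddleForce_lipschitz (hF : ForceSplitting E Lin Non L) (a b : Euc d) :
    ‖saddleForce E b - saddleForce E a‖ ≤ (2 * L) * ‖b - a‖ := by
  rw [hF.split, hF.split, add_sub_add_comm]
  linarith [norm_add_le (Lin b - Lin a) (Non b - Non a), hF.lin_lipschitz a b,
    hF.non_lipschitz a b]

theorem ForceSplitting.norm_lin_le (hF : ForceSplitting E Lin Non L) (a : Euc d) :
    ‖Lin a‖ ≤ L * ‖a‖ := by
  simpa using hF.lin_lipschitz 0 a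

theorem ForceSplitting.norm_saddleForce_le (hF : ForceSplitting E Lin Non L) (a : Euc d) :
    ‖saddleForce E a‖ ≤ 2 * L * (1 + ‖a‖) := by
  rw [hF.split]
  have h := hF.growth a
  linarith [norm_add_le (Lin a) (Non a), (le_max_left _ _).trans h, (le_max_right _ _).trans h]

theorem ForceSplitting.norm_saddleJ_le (hF : ForceSplitting E Lin Non L) (a : Euc d) :
    ‖saddleJ E a‖ ≤ ‖saddleJ E 0‖ + L * ‖a‖ := by
  have h := hF.saddleJ_lipschitz 0 a
  rw [sub_zero] at h
  linarith [norm_le_norm_add_norm_sub' (saddleJ E a) (saddleJ E 0)]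

/-- The Hessian of a `C²` function is symmetric. -/
theorem inner_saddleJ_comm (hE : ContDiff ℝ 2 E) (x a b : Euc d) :
    ⟪a, saddleJ E x b⟫_ℝ = ⟪saddleJ E x a, b⟫_ℝ := by
  have hd : DifferentiableAt ℝ (fderiv ℝ E) x :=
    ((hE.fderiv_right (m := 1) (by norm_num)).differentiable (by norm_num)) x
  have hsymm : IsSymmSndFDerivAt ℝ E x := hE.contDiffAt.isSymmSndFDerivAt (by simp)
  -- over `ℝ` the conjugate-linear Riesz isomorphism is linear
  let Φ : StrongDual ℝ (Euc d) →L[ℝ] Euc d := LinearMap.toContinuousLinearMap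
    { toFun := (InnerProductSpace.toDual ℝ (Euc d)).symm
      map_add' := map_add _
      map_smul' := fun c f => by simp }
  have hgrad : ∀ c e : Euc d, ⟪saddleJ E x c, e⟫_ℝ = -(fderiv ℝ (fderiv ℝ E) x c e) := by
    intro c e
    have h1 : HasFDerivAt (gradient E) (Φ.comp (fderiv ℝ (fderiv ℝ E) x)) x :=
      Φ.hasFDerivAt.comp x hd.hasFDerivAt
    have h2 : Φ (fderiv ℝ (fderiv ℝ E) x c) =
        (InnerProductSpace.toDual ℝ (Euc d)).symm (fderiv ℝ (fderiv ℝ E) x c) := rfl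
    rw [saddleJ, h1.fderiv, neg_apply, inner_neg_left, ContinuousLinearMap.comp_apply, h2,
      InnerProductSpace.toDual_symm_apply]
  rw [real_inner_comm, hgrad, hgrad, hsymm.eq]

end Force

/-! ### Tangency of the vector field -/

section Fields

variable {d k : ℕ}

/-- The right-hand side of the evolution of the position in the saddle dynamics. -/
noncomputable def positionField (E : Euc d → ℝ) (x : Euc d) (v : Fin k → Euc d) : Euc d :=
  saddleForce E x - ⟪x, saddleForce E x⟫_ℝ • x - (2 : ℝ) • ∑ j, ⟪v j, saddleForce E x⟫_ℝ • v j

/-- The right-hand side of the evolution of the `i`-th direction in the saddle dynamics. -/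
noncomputable def directionField (E : Euc d → ℝ) (x : Euc d) (v : Fin k → Euc d) (i : Fin k) :
    Euc d :=
  saddleJ E x (v i) - ⟪x, saddleJ E x (v i)⟫_ℝ • x - ⟪v i, saddleJ E x (v i)⟫_ℝ • v i
    - (2 : ℝ) • ∑ j ∈ Iio i, ⟪v j, saddleJ E x (v i)⟫_ℝ • v j + ⟪v i, saddleForce E x⟫_ℝ • x

variable {E : Euc d → ℝ} {x : Euc d} {v : Fin k → Euc d}

theorem SaddleInitialData.inner_self (h : SaddleInitialData x v) : ⟪x, x⟫_ℝ = 1 := by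
  rw [real_inner_self_eq_norm_sq, h.norm_eq, one_pow]

theorem SaddleInitialData.inner_v (h : SaddleInitialData x v) (i j : Fin k) :
    ⟪v i, v j⟫_ℝ = if i = j then 1 else 0 :=
  orthonormal_iff_ite.1 h.orthonormal i j

theorem SaddleInitialData.tangent' (h : SaddleInitialData x v) (i : Fin k) : ⟪v i, x⟫_ℝ = 0 := by
  rw [real_inner_comm, h.tangent]

/-- The position field is tangent to the sphere. -/
theorem inner_positionField_self (h : SaddleInitialData x v) : ⟪positionField E x v, x⟫_ℝ = 0 := by
  simp [positionField, inner_sub_left, inner_smul_left, sum_inner, h.norm_eq,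
    h.tangent', real_inner_comm x (saddleForce E x)]

/-- The evolution preserves the orthogonality of the directions to the position. -/
theorem inner_directionField_position (h : SaddleInitialData x v) (i : Fin k) :
    ⟪directionField E x v i, x⟫_ℝ + ⟪v i, positionField E x v⟫_ℝ = 0 := by
  simp only [positionField, directionField, inner_sub_left, inner_add_left, inner_sub_right,
    inner_smul_left, inner_smul_right, sum_inner, inner_sum, h.inner_self, h.tangent', h.inner_v,
    real_inner_comm x (saddleJ E x (v i)), RCLike.conj_to_real]
  simp
  ring

/-- The evolution preserves the length of the directions. -/
theorem inner_directionField_self (h : SaddleInitialData x v) (i : Fin k) :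
    ⟪directionField E x v i, v i⟫_ℝ = 0 := by
  have h0 : ∑ j ∈ Iio i, ⟪v j, saddleJ E x (v i)⟫_ℝ * ⟪v j, v i⟫_ℝ = 0 :=
    sum_eq_zero fun j hj => by
      rw [h.inner_v, if_neg (mem_Iio.1 hj).ne, mul_zero]
  simp only [directionField, inner_sub_left, inner_add_left,
    inner_smul_left, sum_inner, h.tangent, h.inner_v i i,
    real_inner_comm (v i) (saddleJ E x (v i)), RCLike.conj_to_real, h0]
  simp

/-- The evolution preserves the mutual orthogonality of the directions; this is where the
symmetry of the Hessian and the triangular structure of the system enter. -/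
theorem inner_directionField_of_lt (hE : ContDiff ℝ 2 E) (h : SaddleInitialData x v)
    {i j : Fin k} (hji : j < i) :
    ⟪directionField E x v i, v j⟫_ℝ + ⟪v i, directionField E x v j⟫_ℝ = 0 := by
  have h0 : ∑ m ∈ Iio i, ⟪v m, saddleJ E x (v i)⟫_ℝ * ⟪v m, v j⟫_ℝ =
      ⟪v j, saddleJ E x (v i)⟫_ℝ := by
    rw [sum_eq_single_of_mem j (mem_Iio.2 hji) fun m _ hm => by
      rw [h.inner_v, if_neg hm, mul_zero], h.inner_v, if_pos rfl, mul_one]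
  have h1 : ∑ m ∈ Iio j, ⟪v m, saddleJ E x (v j)⟫_ℝ * ⟪v i, v m⟫_ℝ = 0 :=
    sum_eq_zero fun m hm => by
      rw [h.inner_v, if_neg ((mem_Iio.1 hm).trans hji).ne', mul_zero]
  have h2 : ⟪saddleJ E x (v i), v j⟫_ℝ = ⟪v j, saddleJ E x (v i)⟫_ℝ := real_inner_comm _ _
  have h3 : ⟪v i, saddleJ E x (v j)⟫_ℝ = ⟪v j, saddleJ E x (v i)⟫_ℝ := by
    rw [inner_saddleJ_comm hE, h2]
  simp only [directionField, inner_sub_left, inner_add_left, inner_sub_right, inner_add_right,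
    inner_smul_left, inner_smul_right, sum_inner, inner_sum, h.tangent, h.tangent',
    RCLike.conj_to_real, h0, h1, h2, h3, h.inner_v i j, if_neg hji.ne']
  ring

end Fields

/-! ### Consistency of one step -/

section SchemeStep

variable {d k : ℕ}

/-- One step of the semi-implicit scheme, from `(x, v)` to `(x', v')` with the intermediate
quantities `xt`, `vt`, `vh`. -/
structure IsSchemeStep (E : Euc d → ℝ) (Lin : Euc d →ₗ[ℝ] Euc d) (Non : Euc d → Euc d) (τ : ℝ)
    (x : Euc d) (v : Fin k → Euc d) (xt x' : Euc d) (vt vh v' : Fin k → Euc d) : Prop where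
  x_step : xt = x + τ • ((Lin xt + Non x) - (2 : ℝ) • ∑ j, ⟪v j, Lin xt + Non x⟫_ℝ • v j)
      - τ • (⟪x, Lin x + Non x⟫_ℝ • x)
  retraction : x' = ‖xt‖⁻¹ • xt
  v_step : ∀ i, vt i = v i
      + τ • (saddleJ E x' (vt i) - ⟪x', saddleJ E x' (vt i)⟫_ℝ • x'
        - (2 : ℝ) • ∑ j ∈ Iio i, ⟪v' j, saddleJ E x' (vt i)⟫_ℝ • v' j)
      - τ • (⟪v i, saddleJ E x' (v i)⟫_ℝ • v i)
      + τ • (⟪vt i, saddleForce E x'⟫_ℝ • x')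
  transport : ∀ i, vh i = vt i - ⟪vt i, x'⟫_ℝ • x'
  gram_schmidt : ∀ i, v' i = ‖gsResidual (vh i) v' i‖⁻¹ • gsResidual (vh i) v' i

theorem inner_gsResidual_position {w x : Euc d} {u : Fin k → Euc d} {i : Fin k}
    (hw : ⟪w, x⟫_ℝ = 0) (hu : ∀ j < i, ⟪u j, x⟫_ℝ = 0) : ⟪gsResidual w u i, x⟫_ℝ = 0 := by
  rw [gsResidual, inner_sub_left, hw, sum_inner, sum_eq_zero, sub_zero]
  intro j hj
  rw [inner_smul_left, hu j (mem_Iio.1 hj), mul_zero]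

theorem inner_gsResidual_of_lt {w : Euc d} {u : Fin k → Euc d} {i j : Fin k} (hj : j < i)
    (hn : ‖u j‖ = 1) (hu : ∀ m < i, m ≠ j → ⟪u m, u j⟫_ℝ = 0) :
    ⟪gsResidual w u i, u j⟫_ℝ = 0 := by
  rw [gsResidual, inner_sub_left, sum_inner, sum_eq_single_of_mem j (mem_Iio.2 hj)]
  · simp [inner_smul_left, hn]
  · intro m hm hmj
    rw [inner_smul_left, hu m (mem_Iio.1 hm) hmj, mul_zero]

variable {E : Euc d → ℝ} {Lin : Euc d →ₗ[ℝ] Euc d} {Non : Euc d → Euc d} {L : ℝ}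
variable {Ω : Type*} {l : Filter Ω} {τ : Ω → ℝ} {x xt x' : Ω → Euc d}
  {v vt vh v' : Ω → Fin k → Euc d}

theorem boundedAlong_position (hM : ∀ ω, SaddleInitialData (x ω) (v ω)) : BoundedAlong l x :=
  .of_norm_le 1 (.of_forall fun ω => (hM ω).norm_eq.le)

theorem boundedAlong_direction (hM : ∀ ω, SaddleInitialData (x ω) (v ω)) (i : Fin k) :
    BoundedAlong l fun ω => v ω i :=
  .of_norm_le 1 (.of_forall fun ω => ((hM ω).orthonormal.1 i).le)

theorem ForceSplitting.boundedAlong_lin (hF : ForceSplitting E Lin Non L) {a : Ω → Euc d}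
    {u : Ω → ℝ} (ha : a =O[l] u) : (fun ω => Lin (a ω)) =O[l] u :=
  (IsBigO.of_bound L (.of_forall fun ω => hF.norm_lin_le (a ω))).trans ha

theorem ForceSplitting.boundedAlong_saddleForce (hF : ForceSplitting E Lin Non L)
    {a : Ω → Euc d} (ha : BoundedAlong l a) : BoundedAlong l fun ω => saddleForce E (a ω) := by
  refine IsBigO.trans (IsBigO.of_bound (2 * L) (.of_forall fun ω => ?_))
    ((isBigO_refl (fun _ => (1 : ℝ)) l).add ha.norm_left)
  rw [Real.norm_of_nonneg (by positivity)]
  exact hF.norm_saddleForce_le (a ω)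

theorem ForceSplitting.boundedAlong_saddleJ (hF : ForceSplitting E Lin Non L)
    {a : Ω → Euc d} (ha : BoundedAlong l a) : BoundedAlong l fun ω => saddleJ E (a ω) := by
  have h : (fun ω => ‖saddleJ E 0‖ + L * ‖a ω‖) =O[l] fun _ => (1 : ℝ) :=
    (isBigO_const_const _ one_ne_zero l).add (ha.norm_left.const_mul_left L)
  refine IsBigO.trans (IsBigO.of_bound 1 (.of_forall fun ω => ?_)) h
  rw [one_mul]
  exact (hF.norm_saddleJ_le (a ω)).trans (le_abs_self _)

theorem ForceSplitting.boundedAlong_non (hF : ForceSplitting E Lin Non L)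
    {a : Ω → Euc d} (ha : BoundedAlong l a) : BoundedAlong l fun ω => Non (a ω) := by
  refine ((hF.boundedAlong_saddleForce ha).sub (hF.boundedAlong_lin ha)).congr_left fun ω => ?_
  rw [hF.split, add_sub_cancel_left]

theorem isBigO_saddleJ_apply (hF : ForceSplitting E Lin Non L)
    {a b : Ω → Euc d} {u : Ω → ℝ} (ha : BoundedAlong l a) (hb : b =O[l] u) :
    (fun ω => saddleJ E (a ω) (b ω)) =O[l] u :=
  (BoundedAlong.bilin (ContinuousLinearMap.id ℝ (Euc d →L[ℝ] Euc d))
    (hF.boundedAlong_saddleJ ha) hb).congr (fun _ => rfl) (fun _ => one_mul _)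

theorem boundedAlong_positionField (hF : ForceSplitting E Lin Non L)
    (hM : ∀ ω, SaddleInitialData (x ω) (v ω)) :
    BoundedAlong l fun ω => positionField E (x ω) (v ω) := by
  have hx : BoundedAlong l x := boundedAlong_position hM
  have hf := hF.boundedAlong_saddleForce hx
  have hv := boundedAlong_direction (l := l) hM
  exact IsBigO.sub (IsBigO.sub hf (BoundedAlong.inner_smul_isBigO hx hx hf))
    (BoundedAlong.const_smul_sum_inner_smul_isBigO 2 (fun j _ => hv j) hf)

theorem boundedAlong_directionField (hF : ForceSplitting E Lin Non L)
    (hM : ∀ ω, SaddleInitialData (x ω) (v ω)) (i : Fin k) :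
    BoundedAlong l fun ω => directionField E (x ω) (v ω) i := by
  have hx : BoundedAlong l x := boundedAlong_position hM
  have hf := hF.boundedAlong_saddleForce hx
  have hv := boundedAlong_direction (l := l) hM
  have hJ := isBigO_saddleJ_apply hF hx (hv i)
  exact IsBigO.add (IsBigO.sub (IsBigO.sub (IsBigO.sub hJ
    (BoundedAlong.inner_smul_isBigO hx hx hJ)) (BoundedAlong.inner_smul_isBigO (hv i) (hv i) hJ))
    (BoundedAlong.const_smul_sum_inner_smul_isBigO 2 (fun j _ => hv j) hJ))
    (BoundedAlong.inner_smul_isBigO (hv i) hx hf)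

/-- The unnormalized position update is consistent with the position field. -/
theorem xt_congrMod (hF : ForceSplitting E Lin Non L) (hτ : Tendsto τ l (𝓝 0))
    (hM : ∀ ω, SaddleInitialData (x ω) (v ω))
    (hS : ∀ ω, IsSchemeStep E Lin Non (τ ω) (x ω) (v ω) (xt ω) (x' ω) (vt ω) (vh ω) (v' ω)) :
    CongrMod l τ 2 xt fun ω => x ω + τ ω • positionField E (x ω) (v ω) := by
  have hx : BoundedAlong l x := boundedAlong_position hM
  have hv := boundedAlong_direction (l := l) hM
  have hN := hF.boundedAlong_non hx
  have hLx := hF.boundedAlong_lin hx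
  -- `xt - x = τ • g (Lin xt + Non x)` with the affine map `g ω`
  let g : Ω → Euc d → Euc d := fun ω q =>
    q - (2 : ℝ) • ∑ j, ⟪v ω j, q⟫_ℝ • v ω j - ⟪x ω, Lin (x ω) + Non (x ω)⟫_ℝ • x ω
  have hstep : ∀ ω, xt ω = x ω + τ ω • g ω (Lin (xt ω) + Non (x ω)) := fun ω => by
    refine (hS ω).x_step.trans ?_
    simp only [g, smul_sub]
    abel
  have h1 : CongrMod l τ 1 xt x := by
    refine CongrMod.of_implicit hτ hx ?_
    have hone : (fun _ => (1 : ℝ)) =O[l] fun ω => ‖xt ω‖ + 1 :=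
      IsBigO.of_bound 1 (.of_forall fun ω => by
        rw [norm_one, one_mul, Real.norm_of_nonneg (by positivity)]
        linarith [norm_nonneg (xt ω)])
    have hxt : xt =O[l] fun ω => ‖xt ω‖ + 1 :=
      IsBigO.of_bound 1 (.of_forall fun ω => by
        rw [one_mul, Real.norm_of_nonneg (by positivity)]
        linarith)
    have hq : (fun ω => Lin (xt ω) + Non (x ω)) =O[l] fun ω => ‖xt ω‖ + 1 :=
      (hF.boundedAlong_lin hxt).add (hN.trans hone)
    have hg : (fun ω => g ω (Lin (xt ω) + Non (x ω))) =O[l] fun ω => ‖xt ω‖ + 1 :=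
      (hq.sub (BoundedAlong.const_smul_sum_inner_smul_isBigO 2 (fun j _ => hv j) hq)).sub
        ((BoundedAlong.inner_smul_isBigO hx hx (IsBigO.add hLx hN)).trans hone)
    refine ((isBigO_refl τ l).smul hg).congr_left fun ω => ?_
    rw [eq_sub_iff_add_eq', ← hstep]
  have hq : CongrMod l τ 1 (fun ω => Lin (xt ω) + Non (x ω)) fun ω => Lin (x ω) + Non (x ω) :=
    (CongrMod.lipschitz hF.lin_lipschitz h1).add (.refl _)
  have hg : CongrMod l τ 1 (fun ω => g ω (Lin (xt ω) + Non (x ω)))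
      fun ω => g ω (Lin (x ω) + Non (x ω)) :=
    (hq.sub (CongrMod.const_smul_sum_inner_smul hτ 2
      (fun j _ => .refl _) hq (fun j _ => hv j) (IsBigO.add hLx hN))).sub
      (.refl _)
  have h2 := (CongrMod.refl (p := 2) (l := l) (τ := τ) x).add hg.step_smul
  refine ((CongrMod.of_eventuallyEq (.of_forall hstep)).trans h2).trans
    (CongrMod.of_eventuallyEq (.of_forall fun ω => ?_))
  simp only [g, positionField, hF.split]
  congr 2
  abel

/-- The position update is nondegenerate, returns to the sphere, and is consistent with the
position field. -/
theorem position_step (hF : ForceSplitting E Lin Non L) (hτ : Tendsto τ l (𝓝 0))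
    (hM : ∀ ω, SaddleInitialData (x ω) (v ω))
    (hS : ∀ ω, IsSchemeStep E Lin Non (τ ω) (x ω) (v ω) (xt ω) (x' ω) (vt ω) (vh ω) (v' ω)) :
    (∀ᶠ ω in l, xt ω ≠ 0 ∧ ‖x' ω‖ = 1) ∧
      CongrMod l τ 2 x' fun ω => x ω + τ ω • positionField E (x ω) (v ω) := by
  have h1 := xt_congrMod hF hτ hM hS
  have hx : BoundedAlong l x := boundedAlong_position hM
  have hG := boundedAlong_positionField (l := l) hF hM
  obtain ⟨hne, h2⟩ := CongrMod.normalize hτ (h1.inner_of_cancel hτ h1 hx hG hx hG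
    (fun ω => (hM ω).inner_self) fun ω => by
      rw [real_inner_comm (positionField E (x ω) (v ω)), inner_positionField_self (hM ω), add_zero])
  refine ⟨?_, ?_⟩
  · filter_upwards [hne] with ω hω
    exact ⟨hω, by rw [(hS ω).retraction, norm_inv_norm_smul hω]⟩
  · exact (CongrMod.of_eventuallyEq (.of_forall fun ω => (hS ω).retraction)).trans (h2.trans h1)

/-- A quantity that is consistent to second order with an Euler step stays `O(τ)`-close to the
starting point. -/
theorem CongrMod.first_order {W : Type*} [NormedAddCommGroup W] [NormedSpace ℝ W]
    (hτ : Tendsto τ l (𝓝 0)) {a a₀ a₁ : Ω → W}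
    (h : CongrMod l τ 2 a fun ω => a₀ ω + τ ω • a₁ ω) (ha₁ : BoundedAlong l a₁) :
    CongrMod l τ 1 a a₀ := by
  refine (h.of_le hτ (by norm_num)).trans ?_
  refine ((isBigO_refl τ l).smul ha₁).congr (fun ω => ?_) (fun ω => ?_)
  · rw [add_sub_cancel_left]
  · simp

/-- The unnormalized update of the `i`-th direction is consistent with the direction field,
provided that the updates of the previous directions are. -/
theorem vt_congrMod (hF : ForceSplitting E Lin Non L) (hτ : Tendsto τ l (𝓝 0))
    (hM : ∀ ω, SaddleInitialData (x ω) (v ω))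
    (hS : ∀ ω, IsSchemeStep E Lin Non (τ ω) (x ω) (v ω) (xt ω) (x' ω) (vt ω) (vh ω) (v' ω))
    (i : Fin k) (hprev : ∀ j < i, CongrMod l τ 1 (fun ω => v' ω j) fun ω => v ω j) :
    CongrMod l τ 2 (fun ω => vt ω i) fun ω =>
      v ω i + τ ω • directionField E (x ω) (v ω) i := by
  have hx : BoundedAlong l x := boundedAlong_position hM
  have hv := boundedAlong_direction (l := l) hM
  have hx1 : CongrMod l τ 1 x' x :=
    (position_step hF hτ hM hS).2.first_order hτ (boundedAlong_positionField hF hM)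
  have hx' : BoundedAlong l x' := hx.congr hτ hx1
  have hv' : ∀ j < i, BoundedAlong l fun ω => v' ω j := fun j hj => (hv j).congr hτ (hprev j hj)
  have hf' := hF.boundedAlong_saddleForce hx'
  have hf := hF.boundedAlong_saddleForce hx
  -- `vt - v = τ • g vt` with the affine map `g ω`
  let g : Ω → Euc d → Euc d := fun ω y =>
    saddleJ E (x' ω) y - ⟪x' ω, saddleJ E (x' ω) y⟫_ℝ • x' ω
      - ⟪v ω i, saddleJ E (x' ω) (v ω i)⟫_ℝ • v ω i
      - (2 : ℝ) • ∑ j ∈ Iio i, ⟪v' ω j, saddleJ E (x' ω) y⟫_ℝ • v' ω j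
      + ⟪y, saddleForce E (x' ω)⟫_ℝ • x' ω
  have hstep : ∀ ω, vt ω i = v ω i + τ ω • g ω (vt ω i) := fun ω => by
    refine ((hS ω).v_step i).trans ?_
    simp only [g, smul_sub, smul_add]
    abel
  have h1 : CongrMod l τ 1 (fun ω => vt ω i) fun ω => v ω i := by
    refine CongrMod.of_implicit hτ (hv i) ?_
    have hone : (fun _ => (1 : ℝ)) =O[l] fun ω => ‖vt ω i‖ + 1 :=
      IsBigO.of_bound 1 (.of_forall fun ω => by
        rw [norm_one, one_mul, Real.norm_of_nonneg (by positivity)]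
        linarith [norm_nonneg (vt ω i)])
    have hvt : (fun ω => vt ω i) =O[l] fun ω => ‖vt ω i‖ + 1 :=
      IsBigO.of_bound 1 (.of_forall fun ω => by
        rw [one_mul, Real.norm_of_nonneg (by positivity)]
        linarith)
    have hJ := isBigO_saddleJ_apply hF hx' hvt
    have hJv := isBigO_saddleJ_apply hF hx' (hv i)
    have hf2 : (fun ω => ⟪vt ω i, saddleForce E (x' ω)⟫_ℝ • x' ω) =O[l] fun ω => ‖vt ω i‖ + 1 :=
      (BoundedAlong.bilin (innerSL ℝ) hvt hf').smul hx' |>.congr (fun _ => rfl) fun ω => by simp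
    have hg : (fun ω => g ω (vt ω i)) =O[l] fun ω => ‖vt ω i‖ + 1 :=
      ((((hJ.sub (BoundedAlong.inner_smul_isBigO hx' hx' hJ)).sub
        ((BoundedAlong.inner_smul_isBigO (hv i) (hv i) hJv).trans hone)).sub
        (BoundedAlong.const_smul_sum_inner_smul_isBigO 2
          (fun j hj => hv' j (mem_Iio.1 hj)) hJ))).add
        hf2
    refine ((isBigO_refl τ l).smul hg).congr_left fun ω => ?_
    rw [eq_sub_iff_add_eq', ← hstep]
  have hJx : BoundedAlong l fun ω => saddleJ E (x ω) := hF.boundedAlong_saddleJ hx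
  have hJJ : CongrMod l τ 1 (fun ω => saddleJ E (x' ω)) fun ω => saddleJ E (x ω) :=
    CongrMod.lipschitz hF.saddleJ_lipschitz hx1
  have hff : CongrMod l τ 1 (fun ω => saddleForce E (x' ω)) fun ω => saddleForce E (x ω) :=
    CongrMod.lipschitz hF.saddleForce_lipschitz hx1
  have hJt : CongrMod l τ 1 (fun ω => saddleJ E (x' ω) (vt ω i))
      fun ω => saddleJ E (x ω) (v ω i) := hJJ.apply hτ h1 hJx (hv i)
  have hJv : CongrMod l τ 1 (fun ω => saddleJ E (x' ω) (v ω i))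
      fun ω => saddleJ E (x ω) (v ω i) := hJJ.apply hτ (.refl _) hJx (hv i)
  have hb := isBigO_saddleJ_apply hF hx (hv i)
  have hg : CongrMod l τ 1 (fun ω => g ω (vt ω i))
      fun ω => directionField E (x ω) (v ω) i :=
    (((hJt.sub (hx1.inner_smul hτ hJt hx1 hx hb hx)).sub
      ((CongrMod.refl _).inner_smul hτ hJv (.refl _) (hv i) hb (hv i))).sub
      (CongrMod.const_smul_sum_inner_smul hτ 2
        (fun j hj => hprev j (mem_Iio.1 hj)) hJt (fun j _ => hv j) hb)).add
      (h1.inner_smul hτ hff hx1 (hv i) hf hx)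
  exact (CongrMod.of_eventuallyEq (.of_forall hstep)).trans
    ((CongrMod.refl (p := 2) (l := l) (τ := τ) fun ω => v ω i).add hg.step_smul)

/-- The update of each direction is nondegenerate, keeps the frame orthonormal and tangent, and
is consistent with the direction field. -/
theorem direction_step (hE : ContDiff ℝ 2 E) (hF : ForceSplitting E Lin Non L)
    (hτ : Tendsto τ l (𝓝 0)) (hM : ∀ ω, SaddleInitialData (x ω) (v ω))
    (hS : ∀ ω, IsSchemeStep E Lin Non (τ ω) (x ω) (v ω) (xt ω) (x' ω) (vt ω) (vh ω) (v' ω))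
    (i : Fin k) :
    (∀ᶠ ω in l, gsResidual (vh ω i) (v' ω) i ≠ 0 ∧ ‖v' ω i‖ = 1 ∧ ⟪v' ω i, x' ω⟫_ℝ = 0 ∧
        ∀ j < i, ⟪v' ω i, v' ω j⟫_ℝ = 0) ∧
      CongrMod l τ 2 (fun ω => v' ω i) fun ω =>
        v ω i + τ ω • directionField E (x ω) (v ω) i := by
  induction i using WellFoundedLT.induction with
  | ind i ih =>
  have hx : BoundedAlong l x := boundedAlong_position hM
  have hv := boundedAlong_direction (l := l) hM
  have hGx := boundedAlong_positionField (l := l) hF hM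
  have hGv := boundedAlong_directionField (l := l) hF hM
  obtain ⟨hx'1, hx'2⟩ := position_step hF hτ hM hS
  have hx' : BoundedAlong l x' := hx.congr hτ (hx'2.first_order hτ hGx)
  have hprev : ∀ j < i, CongrMod l τ 1 (fun ω => v' ω j) fun ω => v ω j := fun j hj =>
    (ih j hj).2.first_order hτ (hGv j)
  have hv' : ∀ j < i, BoundedAlong l fun ω => v' ω j := fun j hj => (hv j).congr hτ (hprev j hj)
  have hvt := vt_congrMod hF hτ hM hS i hprev
  -- the projections in the transport and Gram-Schmidt steps remove only `O(τ²)`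
  have hvh : CongrMod l τ 2 (fun ω => vh ω i) fun ω => vt ω i := by
    have h1 : CongrMod l τ 2 (fun ω => ⟪vt ω i, x' ω⟫_ℝ) fun _ => 0 :=
      hvt.inner_of_cancel hτ hx'2 (hv i) (hGv i) hx hGx (fun ω => (hM ω).tangent' i)
        fun ω => inner_directionField_position (hM ω) i
    have h2 := h1.bilin hτ (ContinuousLinearMap.lsmul ℝ ℝ) (CongrMod.refl x')
      (isBigO_zero _ _) hx'
    refine ((CongrMod.of_eventuallyEq (.of_forall fun ω => (hS ω).transport i)).trans
      ((CongrMod.refl _).sub h2)).trans (CongrMod.of_eventuallyEq (.of_forall fun ω => ?_))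
    simp
  have hvhe := hvh.trans hvt
  have hw : CongrMod l τ 2 (fun ω => gsResidual (vh ω i) (v' ω) i) fun ω =>
      v ω i + τ ω • directionField E (x ω) (v ω) i := by
    have h2 : ∀ j ∈ Iio i, CongrMod l τ 2 (fun ω => ⟪vh ω i, v' ω j⟫_ℝ • v' ω j)
        fun _ => (0 : Euc d) := fun j hj => by
      have hj := mem_Iio.1 hj
      have h1 : CongrMod l τ 2 (fun ω => ⟪vh ω i, v' ω j⟫_ℝ) fun _ => 0 :=
        hvhe.inner_of_cancel hτ (ih j hj).2 (hv i) (hGv i) (hv j) (hGv j)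
          (fun ω => by rw [(hM ω).inner_v, if_neg hj.ne'])
          fun ω => inner_directionField_of_lt hE (hM ω) hj
      refine (h1.bilin hτ (ContinuousLinearMap.lsmul ℝ ℝ) (CongrMod.refl fun ω => v' ω j)
        (isBigO_zero _ _) (hv' j hj)).trans (CongrMod.of_eventuallyEq (.of_forall fun ω => ?_))
      simp
    have h3 := hvhe.sub (CongrMod.sum h2)
    simpa only [sum_const_zero, sub_zero, gsResidual] using h3
  obtain ⟨hne, hn⟩ := CongrMod.normalize hτ (hw.inner_of_cancel hτ hw (hv i) (hGv i) (hv i) (hGv i)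
    (c := 1) (fun ω => by rw [(hM ω).inner_v, if_pos rfl]) fun ω => by
      rw [real_inner_comm (directionField E (x ω) (v ω) i), inner_directionField_self (hM ω),
        add_zero])
  refine ⟨?_, (CongrMod.of_eventuallyEq (.of_forall fun ω => (hS ω).gram_schmidt i)).trans
    (hn.trans hw)⟩
  have hprev' : ∀ᶠ ω in l, ∀ j < i, ‖v' ω j‖ = 1 ∧ ⟪v' ω j, x' ω⟫_ℝ = 0 ∧
      ∀ m < j, ⟪v' ω j, v' ω m⟫_ℝ = 0 :=
    eventually_all.2 fun j => by
      by_cases hj : j < i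
      · filter_upwards [(ih j hj).1] with ω hω _ using hω.2
      · exact .of_forall fun ω h => absurd h hj
  filter_upwards [hne, hprev', hx'1] with ω h1 h2 h3
  have hvhx : ⟪vh ω i, x' ω⟫_ℝ = 0 := by
    rw [(hS ω).transport, inner_sub_left, inner_smul_left, real_inner_self_eq_norm_sq, h3.2]
    simp
  refine ⟨h1, by rw [(hS ω).gram_schmidt, norm_inv_norm_smul h1], ?_, fun j hj => ?_⟩
  · rw [(hS ω).gram_schmidt, inner_smul_left,
      inner_gsResidual_position hvhx fun j hj => (h2 j hj).2.1, mul_zero]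
  · rw [(hS ω).gram_schmidt i, inner_smul_left, inner_gsResidual_of_lt hj (h2 j hj).1, mul_zero]
    intro m hm hmj
    rcases lt_or_gt_of_ne hmj with h | h
    · rw [real_inner_comm, (h2 j hj).2.2 m h]
    · exact (h2 m hm).2.2 j h

end SchemeStep

/-! ### Uniformity in the starting point -/

section UniformStep

variable {d k : ℕ} {E : Euc d → ℝ} {Lin : Euc d →ₗ[ℝ] Euc d} {Non : Euc d → Euc d} {L : ℝ}

/-- For small `τ`, every step of the scheme from a point of the constraint manifold is
nondegenerate, returns to the manifold, and differs from an explicit Euler step by at most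
`C τ²`, uniformly in the starting point. -/
theorem exists_uniform_step (k : ℕ) (hE : ContDiff ℝ 2 E) (hF : ForceSplitting E Lin Non L) :
    ∃ τ₀ > (0 : ℝ), ∃ C > (0 : ℝ), ∀ τ : ℝ, 0 < τ → τ ≤ τ₀ →
      ∀ (x : Euc d) (v : Fin k → Euc d) (xt x' : Euc d) (vt vh v' : Fin k → Euc d),
        SaddleInitialData x v → IsSchemeStep E Lin Non τ x v xt x' vt vh v' →
        (xt ≠ 0 ∧ ∀ i, gsResidual (vh i) v' i ≠ 0) ∧ SaddleInitialData x' v' ∧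
        ‖x' - (x + τ • positionField E x v)‖ ≤ C * τ ^ 2 ∧
        ∀ i, ‖v' i - (v i + τ • directionField E x v i)‖ ≤ C * τ ^ 2 := by
  let Ω := {ω : ℝ × (Euc d × (Fin k → Euc d)) × (Euc d × Euc d) ×
      (Fin k → Euc d) × (Fin k → Euc d) × (Fin k → Euc d) //
    SaddleInitialData ω.2.1.1 ω.2.1.2 ∧ IsSchemeStep E Lin Non ω.1 ω.2.1.1 ω.2.1.2
      ω.2.2.1.1 ω.2.2.1.2 ω.2.2.2.1 ω.2.2.2.2.1 ω.2.2.2.2.2}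
  let τf : Ω → ℝ := fun ω => ω.1.1
  have hτ : Tendsto τf (comap τf (𝓝 0)) (𝓝 0) := tendsto_comap
  obtain ⟨hx1, hx2⟩ := position_step hF hτ (fun ω => ω.2.1) fun ω => ω.2.2
  have hv := direction_step hE hF hτ (fun ω => ω.2.1) fun ω => ω.2.2
  obtain ⟨Cx, hCx, hbx⟩ := IsBigO.exists_pos hx2
  choose Cv hCv hbv using fun i => IsBigO.exists_pos (hv i).2
  have hbv' := eventually_all.2 fun i => (hbv i).bound
  have hv' := eventually_all.2 fun i => (hv i).1
  obtain ⟨s, hs, hsub⟩ := mem_comap.1 (hx1.and (hv'.and (hbx.bound.and hbv')))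
  obtain ⟨ε, hε, hball⟩ := Metric.mem_nhds_iff.1 hs
  refine ⟨ε / 2, half_pos hε, Cx + ∑ i, Cv i,
    add_pos_of_pos_of_nonneg hCx (sum_nonneg fun i _ => (hCv i).le), ?_⟩
  intro τ hτ0 hτε x v xt x' vt vh v' hM hS
  have hmem : τ ∈ Metric.ball (0 : ℝ) ε := by
    rw [Metric.mem_ball, dist_zero_right, Real.norm_of_nonneg hτ0.le]
    linarith
  obtain ⟨h1, h2, h3, h4⟩ := hsub
    (show (⟨(τ, (x, v), (xt, x'), vt, vh, v'), hM, hS⟩ : Ω) ∈ τf ⁻¹' s from hball hmem)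
  simp only [τf] at h1 h2 h3 h4
  rw [Real.norm_of_nonneg (by positivity)] at h3
  simp only [Real.norm_of_nonneg (sq_nonneg τ)] at h4
  have hsum : 0 ≤ ∑ i, Cv i := sum_nonneg fun i _ => (hCv i).le
  refine ⟨⟨h1.1, fun i => (h2 i).1⟩, ⟨h1.2, ⟨fun i => (h2 i).2.1, fun i j hij => ?_⟩, fun i => ?_⟩,
    h3.trans ?_, fun i => (h4 i).trans ?_⟩
  · rcases lt_or_gt_of_ne hij with h | h
    · rw [real_inner_comm]
      exact (h2 j).2.2.2 i h
    · exact (h2 i).2.2.2 j h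
  · rw [real_inner_comm]
    exact (h2 i).2.2.1
  · nlinarith [sq_nonneg τ]
  · have : Cv i ≤ ∑ j, Cv j := single_le_sum (fun j _ => (hCv j).le) (mem_univ i)
    nlinarith [sq_nonneg τ]

end UniformStep

/-! ### Solvability of the scheme -/

section Existence

theorem exists_eq_add_of_norm_le {V : Type*} [NormedAddCommGroup V] [NormedSpace ℝ V]
    [FiniteDimensional ℝ V] (A : V →ₗ[ℝ] V) {c : ℝ} (hc : c < 1) (hA : ∀ y, ‖A y‖ ≤ c * ‖y‖)
    (b : V) : ∃ y, y = b + A y := by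
  have hinj : Function.Injective ((LinearMap.id : V →ₗ[ℝ] V) - A) := by
    rw [← LinearMap.ker_eq_bot, LinearMap.ker_eq_bot']
    intro y hy
    have h1 : y = A y := sub_eq_zero.1 hy
    have h2 := hA y
    rw [← h1] at h2
    by_contra hne
    have := norm_pos_iff.2 hne
    nlinarith
  obtain ⟨y, hy⟩ := (LinearMap.injective_iff_surjective.1 hinj) b
  exact ⟨y, sub_eq_iff_eq_add.1 hy⟩

/-- Successive choice: if a value at `i` can be found for any previous values, then there is a
family solving all the conditions at once. -/
theorem exists_fin_family {k : ℕ} {α : Type*} (good : α → Prop)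
    (P : Fin k → (Fin k → α) → α → Prop) (hgood : ∃ a, good a)
    (hP : ∀ i u u' a, (∀ j < i, u j = u' j) → P i u a → P i u' a)
    (hex : ∀ i u, (∀ j, good (u j)) → ∃ a, good a ∧ P i u a) :
    ∃ u : Fin k → α, (∀ i, good (u i)) ∧ ∀ i, P i u (u i) := by
  have key : ∀ m : ℕ, m ≤ k → ∃ u : Fin k → α, (∀ i, good (u i)) ∧
      ∀ i : Fin k, (i : ℕ) < m → P i u (u i) := by
    intro m
    induction m with
    | zero =>
      obtain ⟨a, ha⟩ := hgood
      exact fun _ => ⟨fun _ => a, fun _ => ha, fun i hi => absurd hi (by simp)⟩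
    | succ m ih =>
      intro hm
      obtain ⟨u, hu, hPu⟩ := ih (by omega)
      obtain ⟨i₀, hi₀⟩ : ∃ i₀ : Fin k, (i₀ : ℕ) = m := ⟨⟨m, by omega⟩, rfl⟩
      obtain ⟨a, ha, hPa⟩ := hex i₀ u hu
      have hagree : ∀ i ≤ i₀, ∀ j < i, u j = Function.update u i₀ a j := fun i hi j hj => by
        rw [Function.update_of_ne (hj.trans_le hi).ne]
      refine ⟨Function.update u i₀ a, fun i => ?_, fun i hi => ?_⟩
      · by_cases h : i = i₀
        · rw [h, Function.update_self]; exact ha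
        · rw [Function.update_of_ne h]; exact hu i
      · have hle : i ≤ i₀ := by rw [Fin.le_def]; omega
        refine hP _ _ _ _ (hagree i hle) ?_
        rcases hle.eq_or_lt with h | h
        · rw [h, Function.update_self]
          exact hPa
        · rw [Function.update_of_ne h.ne]
          exact hPu i (hi₀ ▸ h)
  obtain ⟨u, hu, hPu⟩ := key k le_rfl
  exact ⟨u, hu, fun i => hPu i i.2⟩

theorem norm_inv_norm_smul_le {V : Type*} [NormedAddCommGroup V] [NormedSpace ℝ V] (w : V) :
    ‖‖w‖⁻¹ • w‖ ≤ 1 := by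
  rw [norm_smul, norm_inv, norm_norm]
  exact inv_mul_le_one

theorem norm_inner_smul_le {V : Type*} [NormedAddCommGroup V] [InnerProductSpace ℝ V] {a b f : V}
    {D : ℝ} (h : ‖a‖ * ‖b‖ ≤ D) : ‖⟪a, f⟫_ℝ • b‖ ≤ D * ‖f‖ := by
  rw [norm_smul]
  have h1 : ‖⟪a, f⟫_ℝ‖ ≤ ‖a‖ * ‖f‖ := norm_inner_le_norm a f
  calc ‖⟪a, f⟫_ℝ‖ * ‖b‖ ≤ (‖a‖ * ‖f‖) * ‖b‖ := by gcongr
    _ = (‖a‖ * ‖b‖) * ‖f‖ := by ring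
    _ ≤ D * ‖f‖ := by gcongr

theorem norm_two_smul_sum_le {V : Type*} [NormedAddCommGroup V] [InnerProductSpace ℝ V] {k : ℕ}
    {v : Fin k → V} (hv : ∀ i, ‖v i‖ ≤ 1) (s : Finset (Fin k)) (f : V) :
    ‖(2 : ℝ) • ∑ j ∈ s, ⟪v j, f⟫_ℝ • v j‖ ≤ 2 * k * ‖f‖ := by
  rw [norm_smul, Real.norm_ofNat, mul_assoc]
  gcongr
  calc ‖∑ j ∈ s, ⟪v j, f⟫_ℝ • v j‖ ≤ ∑ j ∈ s, 1 * ‖f‖ :=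
        norm_sum_le_of_le _ fun j _ => norm_inner_smul_le
          (mul_le_one₀ (hv j) (norm_nonneg _) (hv j))
    _ = s.card * ‖f‖ := by simp
    _ ≤ k * ‖f‖ := by
        gcongr
        simpa using s.card_le_univ

variable {d k : ℕ} {E : Euc d → ℝ} {Lin : Euc d →ₗ[ℝ] Euc d} {Non : Euc d → Euc d} {L : ℝ}

/-- The map `q ↦ q - 2 ∑_{j ∈ s} ⟪u j, q⟫ u j`, a reflection when the `u j` are orthonormal. -/
noncomputable def frameReflection (s : Finset (Fin k)) (u : Fin k → Euc d) : Euc d →ₗ[ℝ] Euc d :=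
  LinearMap.id - (2 : ℝ) • ∑ j ∈ s, (innerₛₗ ℝ (u j)).smulRight (u j)

theorem frameReflection_apply (s : Finset (Fin k)) (u : Fin k → Euc d) (q : Euc d) :
    frameReflection s u q = q - (2 : ℝ) • ∑ j ∈ s, ⟪u j, q⟫_ℝ • u j := by
  simp [frameReflection, LinearMap.sum_apply]

theorem norm_frameReflection_le {u : Fin k → Euc d} (hu : ∀ i, ‖u i‖ ≤ 1) (s : Finset (Fin k))
    (q : Euc d) : ‖frameReflection s u q‖ ≤ (1 + 2 * k) * ‖q‖ := by
  rw [frameReflection_apply]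
  linarith [norm_sub_le q ((2 : ℝ) • ∑ j ∈ s, ⟪u j, q⟫_ℝ • u j), norm_two_smul_sum_le hu s q]

/-- The linear system for the position. -/
theorem exists_position_solve (hF : ForceSplitting E Lin Non L) {τ : ℝ} (hτ0 : 0 ≤ τ)
    {v : Fin k → Euc d} (hv : ∀ i, ‖v i‖ ≤ 1) (hτ : τ * ((1 + 2 * k) * L) < 1) (x : Euc d) :
    ∃ xt, xt = x + τ • ((Lin xt + Non x) - (2 : ℝ) • ∑ j, ⟪v j, Lin xt + Non x⟫_ℝ • v j)
      - τ • (⟪x, Lin x + Non x⟫_ℝ • x) := by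
  obtain ⟨y, hy⟩ := exists_eq_add_of_norm_le (τ • frameReflection univ v ∘ₗ Lin) hτ (fun y => by
    rw [LinearMap.smul_apply, norm_smul, Real.norm_of_nonneg hτ0, mul_assoc, mul_assoc]
    refine mul_le_mul_of_nonneg_left ((norm_frameReflection_le hv _ _).trans ?_) hτ0
    exact mul_le_mul_of_nonneg_left (hF.norm_lin_le y) (by positivity))
    (x + τ • frameReflection univ v (Non x) - τ • (⟪x, Lin x + Non x⟫_ℝ • x))
  refine ⟨y, hy.trans ?_⟩
  rw [← frameReflection_apply, map_add, LinearMap.smul_apply, LinearMap.comp_apply, smul_add]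
  abel

/-- The linear system for a single direction, the previous ones `u` being given. -/
theorem exists_direction_solve {τ M D : ℝ} (hτ0 : 0 ≤ τ) {x' f : Euc d} (hx' : ‖x'‖ ≤ 1)
    {J : Euc d →L[ℝ] Euc d} (hJ : ‖J‖ ≤ M) (hf : ‖f‖ ≤ D) (hτ : τ * ((2 + 2 * k) * M + D) < 1)
    {u : Fin k → Euc d} (hu : ∀ i, ‖u i‖ ≤ 1) (s : Finset (Fin k)) (w z : Euc d) :
    ∃ y, y = w + τ • (J y - ⟪x', J y⟫_ℝ • x' - (2 : ℝ) • ∑ j ∈ s, ⟪u j, J y⟫_ℝ • u j) - τ • z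
      + τ • (⟪y, f⟫_ℝ • x') := by
  let A : Euc d →ₗ[ℝ] Euc d := τ • (frameReflection s u ∘ₗ J.toLinearMap
    - (innerₛₗ ℝ x').smulRight x' ∘ₗ J.toLinearMap + (innerₛₗ ℝ f).smulRight x')
  have hA : ∀ y, A y = τ • (frameReflection s u (J y) - ⟪x', J y⟫_ℝ • x' + ⟪f, y⟫_ℝ • x') :=
    fun y => by simp [A]
  obtain ⟨y, hy⟩ := exists_eq_add_of_norm_le A hτ (fun y => by
    have hJy : ‖J y‖ ≤ M * ‖y‖ := J.le_of_opNorm_le hJ y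
    rw [hA, norm_smul, Real.norm_of_nonneg hτ0, mul_assoc]
    refine mul_le_mul_of_nonneg_left ?_ hτ0
    have h1 := norm_frameReflection_le hu s (J y)
    have h2 : ‖⟪x', J y⟫_ℝ • x'‖ ≤ 1 * ‖J y‖ :=
      norm_inner_smul_le (mul_le_one₀ hx' (norm_nonneg _) hx')
    have h3 : ‖⟪f, y⟫_ℝ • x'‖ ≤ D * ‖y‖ :=
      norm_inner_smul_le ((mul_le_of_le_one_right (norm_nonneg _) hx').trans hf)
    calc _ ≤ (1 + 2 * k) * ‖J y‖ + 1 * ‖J y‖ + D * ‖y‖ :=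
          (norm_add_le _ _).trans (add_le_add ((norm_sub_le _ _).trans (add_le_add h1 h2)) h3)
      _ = (2 + 2 * k) * ‖J y‖ + D * ‖y‖ := by ring
      _ ≤ (2 + 2 * k) * (M * ‖y‖) + D * ‖y‖ := by gcongr
      _ = ((2 + 2 * k) * M + D) * ‖y‖ := by ring)
    (w - τ • z)
  refine ⟨y, hy.trans ?_⟩
  rw [hA, frameReflection_apply, real_inner_comm y f]
  simp only [smul_add, smul_sub]
  abel

/-- All the directions can be computed successively. -/
theorem exists_directions_solve {τ M D : ℝ} (hτ0 : 0 ≤ τ) {x' f : Euc d} (hx' : ‖x'‖ ≤ 1)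
    {J : Euc d →L[ℝ] Euc d} (hJ : ‖J‖ ≤ M) (hf : ‖f‖ ≤ D) (hτ : τ * ((2 + 2 * k) * M + D) < 1)
    (w z : Fin k → Euc d) :
    ∃ vt vh v' : Fin k → Euc d, (∀ i, ‖v' i‖ ≤ 1) ∧
      (∀ i, vt i = w i + τ • (J (vt i) - ⟪x', J (vt i)⟫_ℝ • x'
        - (2 : ℝ) • ∑ j ∈ Iio i, ⟪v' j, J (vt i)⟫_ℝ • v' j) - τ • z i
        + τ • (⟪vt i, f⟫_ℝ • x')) ∧
      (∀ i, vh i = vt i - ⟪vt i, x'⟫_ℝ • x') ∧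
      ∀ i, v' i = ‖gsResidual (vh i) v' i‖⁻¹ • gsResidual (vh i) v' i := by
  -- the components of `a : Euc d × Euc d × Euc d` are the candidates for `vt i`, `vh i`, `v' i`
  let P : Fin k → (Fin k → Euc d × Euc d × Euc d) → Euc d × Euc d × Euc d → Prop := fun i u a =>
    a.1 = w i + τ • (J a.1 - ⟪x', J a.1⟫_ℝ • x'
        - (2 : ℝ) • ∑ j ∈ Iio i, ⟪(u j).2.2, J a.1⟫_ℝ • (u j).2.2) - τ • z i
        + τ • (⟪a.1, f⟫_ℝ • x') ∧
      a.2.1 = a.1 - ⟪a.1, x'⟫_ℝ • x' ∧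
      a.2.2 = ‖gsResidual a.2.1 (fun j => (u j).2.2) i‖⁻¹ •
        gsResidual a.2.1 (fun j => (u j).2.2) i
  have hP : ∀ i u u' a, (∀ j < i, u j = u' j) → P i u a → P i u' a := by
    intro i u u' a hagree h
    have h1 : ∑ j ∈ Iio i, ⟪(u j).2.2, J a.1⟫_ℝ • (u j).2.2 =
        ∑ j ∈ Iio i, ⟪(u' j).2.2, J a.1⟫_ℝ • (u' j).2.2 :=
      sum_congr rfl fun j hj => by rw [hagree j (mem_Iio.1 hj)]
    have h2 : gsResidual a.2.1 (fun j => (u j).2.2) i =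
        gsResidual a.2.1 (fun j => (u' j).2.2) i := by
      simp only [gsResidual]
      congr 1
      exact sum_congr rfl fun j hj => by rw [hagree j (mem_Iio.1 hj)]
    simp only [P] at h ⊢
    rwa [h1, h2] at h
  obtain ⟨u, hu, hPu⟩ := exists_fin_family (fun a : Euc d × Euc d × Euc d => ‖a.2.2‖ ≤ 1) P
    ⟨(0, 0, 0), norm_zero.trans_le zero_le_one⟩ hP fun i u hu => by
      obtain ⟨y, hy⟩ := exists_direction_solve hτ0 hx' hJ hf hτ hu (Iio i) (w i) (z i)
      obtain ⟨g, hg⟩ : ∃ g, g = gsResidual (y - ⟪y, x'⟫_ℝ • x') (fun j => (u j).2.2) i := ⟨_, rfl⟩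
      exact ⟨(y, y - ⟪y, x'⟫_ℝ • x', ‖g‖⁻¹ • g), norm_inv_norm_smul_le g, hy, rfl, by rw [hg]⟩
  simp only [P] at hPu
  refine ⟨fun i => (u i).1, fun i => (u i).2.1, fun i => (u i).2.2, hu, ?_, ?_, ?_⟩
  · exact fun i => (hPu i).1
  · exact fun i => (hPu i).2.1
  · exact fun i => (hPu i).2.2

/-- The linear systems of a step are solvable as soon as `τ` is small, since all the vectors
that enter them have norm at most one (a degenerate normalization yields the zero vector). -/
theorem exists_schemeStep (k : ℕ) (hF : ForceSplitting E Lin Non L) :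
    ∃ τ₀ > (0 : ℝ), ∀ τ : ℝ, 0 < τ → τ ≤ τ₀ → ∀ (x : Euc d) (v : Fin k → Euc d),
      (∀ i, ‖v i‖ ≤ 1) → ∃ (xt x' : Euc d) (vt vh v' : Fin k → Euc d),
        (∀ i, ‖v' i‖ ≤ 1) ∧ IsSchemeStep E Lin Non τ x v xt x' vt vh v' := by
  have hL := hF.pos
  set M : ℝ := ‖saddleJ E 0‖ + L with hM
  have hMpos : 0 ≤ M := by positivity
  obtain ⟨K, hK⟩ : ∃ K, K = (1 + 2 * k) * L + ((2 + 2 * k) * M + 4 * L) := ⟨_, rfl⟩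
  have hK1 : 0 < (1 + 2 * k) * L := by positivity
  have hK2 : 0 < (2 + 2 * k) * M + 4 * L := by positivity
  have hKpos : 0 < K := by linarith
  refine ⟨(2 * K)⁻¹, by positivity, fun τ hτ0 hτ x v hv => ?_⟩
  have hτK : τ * K < 1 := by
    have : τ * K ≤ (2 * K)⁻¹ * K := by gcongr
    have h2 : (2 * K)⁻¹ * K = 1 / 2 := by field_simp
    linarith
  obtain ⟨xt, hxt⟩ := exists_position_solve hF hτ0.le hv
    ((mul_le_mul_of_nonneg_left (by linarith) hτ0.le).trans_lt hτK) x
  obtain ⟨x', hx'⟩ : ∃ x', x' = ‖xt‖⁻¹ • xt := ⟨_, rfl⟩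
  have hx'n : ‖x'‖ ≤ 1 := hx' ▸ norm_inv_norm_smul_le xt
  have hfn : ‖saddleForce E x'‖ ≤ 4 * L := (hF.norm_saddleForce_le x').trans (by nlinarith)
  have hJn : ‖saddleJ E x'‖ ≤ M := (hF.norm_saddleJ_le x').trans (by rw [hM]; nlinarith)
  obtain ⟨vt, vh, v', h1, h2, h3, h4⟩ := exists_directions_solve hτ0.le hx'n hJn hfn
    ((mul_le_mul_of_nonneg_left (by linarith) hτ0.le).trans_lt hτK) v
      fun i => ⟪v i, saddleJ E x' (v i)⟫_ℝ • v i
  exact ⟨xt, x', vt, vh, v', h1, ⟨hxt, hx', h2, h3, h4⟩⟩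

/-- For small `τ` the scheme has a solution. -/
theorem exists_scheme (hF : ForceSplitting E Lin Non L) {x₀ : Euc d} {v₀ : Fin k → Euc d}
    (h₀ : SaddleInitialData x₀ v₀) :
    ∃ τ₀ > (0 : ℝ), ∀ τ : ℝ, 0 < τ → τ ≤ τ₀ → ∀ N : ℕ,
      ∃ S : SchemeData d k, IsSemiImplicitScheme E Lin Non x₀ v₀ τ N S := by
  obtain ⟨τ₀, hτ₀, h⟩ := exists_schemeStep k hF
  refine ⟨τ₀, hτ₀, fun τ hτ hle N => ?_⟩
  choose! fxt fx fvt fvh fv hf using h τ hτ hle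
  -- iterate the solution operator of one step
  let s : ℕ → Euc d × (Fin k → Euc d) := fun n => n.rec (x₀, v₀) fun _ p => (fx p.1 p.2, fv p.1 p.2)
  have hs : ∀ n i, ‖(s n).2 i‖ ≤ 1 := by
    intro n
    induction n with
    | zero => exact fun i => (h₀.orthonormal.1 i).le
    | succ n ih => exact (hf (s n).1 (s n).2 ih).1
  have hstep := fun n => (hf (s n).1 (s n).2 (hs n)).2
  refine ⟨⟨fun n => fxt (s (n - 1)).1 (s (n - 1)).2, fun n => (s n).1,
    fun n => fvt (s (n - 1)).1 (s (n - 1)).2, fun n => fvh (s (n - 1)).1 (s (n - 1)).2,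
    fun n => (s n).2⟩, rfl, rfl, ?_, ?_, ?_, ?_, ?_⟩ <;>
  · intro n hn _
    obtain ⟨m, rfl⟩ : ∃ m, n = m + 1 := ⟨n - 1, by omega⟩
    first
      | exact (hstep m).x_step
      | exact (hstep m).retraction
      | exact (hstep m).v_step
      | exact (hstep m).transport
      | exact (hstep m).gram_schmidt

end Existence

/-! ### Convergence of perturbed Euler methods -/

section Convergence

variable {W : Type*} [NormedAddCommGroup W] [NormedSpace ℝ W]

/-- Local truncation error of the explicit Euler method along a solution that stays in a set on
which the vector field is Lipschitz and bounded. -/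
theorem norm_euler_truncation_le {G : W → W} {s : Set W} {K : NNReal} {M T : ℝ} {u : ℝ → W}
    (hG : LipschitzOnWith K G s) (hM : 0 ≤ M) (hu : ∀ t ∈ Set.Icc 0 T, u t ∈ s)
    (hGM : ∀ w ∈ s, ‖G w‖ ≤ M)
    (hd : ∀ t ∈ Set.Icc 0 T, HasDerivWithinAt u (G (u t)) (Set.Icc 0 T) t)
    {a b : ℝ} (ha : 0 ≤ a) (hab : a ≤ b) (hb : b ≤ T) :
    ‖u b - (u a + (b - a) • G (u a))‖ ≤ K * M * (b - a) ^ 2 := by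
  have hsub : Set.Icc a b ⊆ Set.Icc 0 T := Set.Icc_subset_Icc ha hb
  have hlip : ∀ t ∈ Set.Icc a b, ‖u t - u a‖ ≤ M * (b - a) := fun t ht => by
    have h := (convex_Icc a b).norm_image_sub_le_of_norm_hasDerivWithin_le
      (fun r hr => (hd r (hsub hr)).mono hsub) (fun r hr => hGM _ (hu r (hsub hr)))
      (Set.left_mem_Icc.2 hab) ht
    refine h.trans ?_
    rw [Real.norm_of_nonneg (by linarith [ht.1])]
    gcongr
    exact ht.2
  have hd' : ∀ t ∈ Set.Icc a b, HasDerivWithinAt (fun t => u t - t • G (u a))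
      (G (u t) - G (u a)) (Set.Icc a b) t := fun t ht => by
    have h1 := ((hasDerivAt_id t).smul_const (G (u a))).hasDerivWithinAt (s := Set.Icc a b)
    have h2 := ((hd t (hsub ht)).mono hsub).sub h1
    rw [one_smul] at h2
    exact h2
  have hbound : ∀ t ∈ Set.Icc a b, ‖G (u t) - G (u a)‖ ≤ K * (M * (b - a)) := fun t ht => by
    have h1 := hG.norm_sub_le (hu t (hsub ht)) (hu a (hsub (Set.left_mem_Icc.2 hab)))
    exact h1.trans (by gcongr; exact hlip t ht)
  have h := (convex_Icc a b).norm_image_sub_le_of_norm_hasDerivWithin_le hd' hbound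
    (Set.left_mem_Icc.2 hab) (Set.right_mem_Icc.2 hab)
  have e : u b - (u a + (b - a) • G (u a)) = (u b - b • G (u a)) - (u a - a • G (u a)) := by
    rw [sub_smul]; abel
  rw [e]
  refine h.trans (le_of_eq ?_)
  rw [Real.norm_of_nonneg (by linarith)]
  ring

/-- A discrete Gronwall inequality. -/
theorem discrete_gronwall_bound {e : ℕ → ℝ} {N : ℕ} {τ K D : ℝ} (hτ : 0 ≤ τ) (hK : 0 ≤ K)
    (hD : 0 ≤ D) (h0 : e 0 = 0) (h : ∀ n < N, e (n + 1) ≤ (1 + τ * K) * e n + D * τ ^ 2) :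
    ∀ n ≤ N, e n ≤ D * (n * τ) * Real.exp (K * (n * τ)) * τ := by
  have h1 : ∀ n ≤ N, e n ≤ D * τ ^ 2 * n * (1 + τ * K) ^ n := by
    intro n
    induction n with
    | zero => intro _; simp [h0]
    | succ n ih =>
      intro hn
      have h2 := ih (by omega)
      have hq : 1 ≤ 1 + τ * K := by nlinarith [mul_nonneg hτ hK]
      calc e (n + 1) ≤ (1 + τ * K) * e n + D * τ ^ 2 := h n (by omega)
        _ ≤ (1 + τ * K) * (D * τ ^ 2 * n * (1 + τ * K) ^ n) +
            D * τ ^ 2 * (1 + τ * K) ^ (n + 1) := by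
            refine add_le_add (mul_le_mul_of_nonneg_left h2 (by positivity)) ?_
            exact le_mul_of_one_le_right (mul_nonneg hD (sq_nonneg τ)) (one_le_pow₀ hq)
        _ = D * τ ^ 2 * (n + 1 : ℕ) * (1 + τ * K) ^ (n + 1) := by push_cast; ring
  intro n hn
  have h2 : (1 + τ * K) ^ n ≤ Real.exp (K * (n * τ)) := by
    have h3 : 1 + τ * K ≤ Real.exp (τ * K) := by linarith [Real.add_one_le_exp (τ * K)]
    calc (1 + τ * K) ^ n ≤ Real.exp (τ * K) ^ n := by gcongr
      _ = Real.exp (K * (n * τ)) := by rw [← Real.exp_nat_mul]; congr 1; ring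
  calc e n ≤ D * τ ^ 2 * n * (1 + τ * K) ^ n := h1 n hn
    _ ≤ D * τ ^ 2 * n * Real.exp (K * (n * τ)) := by gcongr
    _ = _ := by ring

/-- A sequence that follows the explicit Euler method up to `C τ²` per step converges with order
one to the solution, as long as both stay in a set on which the vector field is Lipschitz and
bounded. -/
theorem euler_convergence {G : W → W} {s : Set W} {K : NNReal} {M C T : ℝ} {u : ℝ → W}
    (hG : LipschitzOnWith K G s) (hM : 0 ≤ M) (hC : 0 ≤ C) (hu : ∀ t ∈ Set.Icc 0 T, u t ∈ s)
    (hGM : ∀ w ∈ s, ‖G w‖ ≤ M)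
    (hd : ∀ t ∈ Set.Icc 0 T, HasDerivWithinAt u (G (u t)) (Set.Icc 0 T) t)
    {τ : ℝ} (hτ : 0 ≤ τ) {N : ℕ} (hN : N * τ = T) {y : ℕ → W} (hy0 : y 0 = u 0)
    (hys : ∀ n ≤ N, y n ∈ s)
    (hy : ∀ n < N, ‖y (n + 1) - (y n + τ • G (y n))‖ ≤ C * τ ^ 2) :
    ∀ n ≤ N, ‖u (n * τ) - y n‖ ≤ (C + K * M) * T * Real.exp (K * T) * τ := by
  have hmem : ∀ n ≤ N, (n : ℝ) * τ ≤ T := fun n hn => by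
    rw [← hN]
    gcongr
  have hT : 0 ≤ T := by rw [← hN]; positivity
  have key := discrete_gronwall_bound (e := fun n => ‖u (n * τ) - y n‖) (N := N) (τ := τ)
    (K := K) (D := C + K * M) hτ K.2 (by positivity) (by simp [hy0]) fun n hn => by
      have hn0 : (0 : ℝ) ≤ n * τ := by positivity
      have h1 := norm_euler_truncation_le hG hM hu hGM hd hn0
        (b := (n + 1 : ℕ) * τ) (by gcongr; omega) (hmem (n + 1) hn)
      have e1 : ((n + 1 : ℕ) : ℝ) * τ - n * τ = τ := by push_cast; ring
      rw [e1] at h1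
      have h2 := hy n hn
      have h3 := hG.norm_sub_le (hu _ ⟨hn0, hmem n hn.le⟩) (hys n hn.le)
      have e2 : u ((n + 1 : ℕ) * τ) - y (n + 1) =
          (u ((n + 1 : ℕ) * τ) - (u (n * τ) + τ • G (u (n * τ))))
          - (y (n + 1) - (y n + τ • G (y n)))
          + ((u (n * τ) - y n) + τ • (G (u (n * τ)) - G (y n))) := by
        rw [smul_sub]; abel
      rw [e2]
      have h4 : ‖τ • (G (u (n * τ)) - G (y n))‖ ≤ τ * (K * ‖u (n * τ) - y n‖) := by
        rw [norm_smul, Real.norm_of_nonneg hτ]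
        gcongr
      have h5 := norm_add_le ((u ((n + 1 : ℕ) * τ) - (u (n * τ) + τ • G (u (n * τ))))
          - (y (n + 1) - (y n + τ • G (y n))))
          ((u (n * τ) - y n) + τ • (G (u (n * τ)) - G (y n)))
      have h6 := norm_sub_le (u ((n + 1 : ℕ) * τ) - (u (n * τ) + τ • G (u (n * τ))))
          (y (n + 1) - (y n + τ • G (y n)))
      have h7 := norm_add_le (u (n * τ) - y n) (τ • (G (u (n * τ)) - G (y n)))
      linarith
  intro n hn
  refine (key n hn).trans ?_
  have := hmem n hn
  gcongr

end Convergence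

/-! ### Regularity of the vector field and the error estimate -/

section VectorField

variable {d k : ℕ} {E : Euc d → ℝ} {Lin : Euc d →ₗ[ℝ] Euc d} {Non : Euc d → Euc d} {L : ℝ}

/-- The vector field of the saddle dynamics on the product space of positions and directions. -/
noncomputable def saddleField (E : Euc d → ℝ) (p : Euc d × (Fin k → Euc d)) :
    Euc d × (Fin k → Euc d) :=
  (positionField E p.1 p.2, directionField E p.1 p.2)

/-- The vector field of the saddle dynamics, with the force and the Hessian as independent
variables. In contrast to the Hessian, which is merely Lipschitz in `x`, it is smooth, being a
polynomial. -/
noncomputable def saddleFieldAux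
    (q : (Euc d × (Fin k → Euc d)) × Euc d × (Euc d →L[ℝ] Euc d)) : Euc d × (Fin k → Euc d) :=
  (q.2.1 - ⟪q.1.1, q.2.1⟫_ℝ • q.1.1 - (2 : ℝ) • ∑ j, ⟪q.1.2 j, q.2.1⟫_ℝ • q.1.2 j,
    fun i => q.2.2 (q.1.2 i) - ⟪q.1.1, q.2.2 (q.1.2 i)⟫_ℝ • q.1.1
      - ⟪q.1.2 i, q.2.2 (q.1.2 i)⟫_ℝ • q.1.2 i
      - (2 : ℝ) • ∑ j ∈ Iio i, ⟪q.1.2 j, q.2.2 (q.1.2 i)⟫_ℝ • q.1.2 j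
      + ⟪q.1.2 i, q.2.1⟫_ℝ • q.1.1)

theorem ContDiff.inner_smul {X V : Type*} [NormedAddCommGroup X] [NormedSpace ℝ X]
    [NormedAddCommGroup V] [InnerProductSpace ℝ V] {a b f : X → V}
    (ha : ContDiff ℝ 1 a) (hf : ContDiff ℝ 1 f) (hb : ContDiff ℝ 1 b) :
    ContDiff ℝ 1 fun q => ⟪a q, f q⟫_ℝ • b q :=
  (ha.inner ℝ hf).smul hb

theorem ContDiff.const_smul_sum_inner_smul {X V ι : Type*} [NormedAddCommGroup X]
    [NormedSpace ℝ X] [NormedAddCommGroup V] [InnerProductSpace ℝ V] {a : X → ι → V} {f : X → V}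
    (c : ℝ) (s : Finset ι) (ha : ∀ i, ContDiff ℝ 1 fun q => a q i) (hf : ContDiff ℝ 1 f) :
    ContDiff ℝ 1 fun q => c • ∑ i ∈ s, ⟪a q i, f q⟫_ℝ • a q i := by
  have h : ContDiff ℝ 1 fun q => ∑ i ∈ s, ⟪a q i, f q⟫_ℝ • a q i :=
    ContDiff.sum fun i _ => (ha i).inner_smul hf (ha i)
  exact h.const_smul c

theorem contDiff_saddleFieldAux : ContDiff ℝ 1 (saddleFieldAux (d := d) (k := k)) := by
  have hx : ContDiff ℝ 1 fun q : (Euc d × (Fin k → Euc d)) × Euc d × (Euc d →L[ℝ] Euc d) =>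
    q.1.1 := contDiff_fst.fst
  have hv : ∀ i, ContDiff ℝ 1 fun q : (Euc d × (Fin k → Euc d)) × Euc d × (Euc d →L[ℝ] Euc d) =>
    q.1.2 i := fun i => contDiff_pi.1 contDiff_fst.snd i
  have hf : ContDiff ℝ 1 fun q : (Euc d × (Fin k → Euc d)) × Euc d × (Euc d →L[ℝ] Euc d) =>
    q.2.1 := contDiff_snd.fst
  have hJ : ∀ i, ContDiff ℝ 1 fun q : (Euc d × (Fin k → Euc d)) × Euc d × (Euc d →L[ℝ] Euc d) =>
    q.2.2 (q.1.2 i) := fun i => contDiff_snd.snd.clm_apply (hv i)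
  refine ContDiff.prodMk ?_ (contDiff_pi.2 fun i => ?_)
  · exact (hf.sub (hx.inner_smul hf hx)).sub (.const_smul_sum_inner_smul 2 univ hv hf)
  · exact ((((hJ i).sub (hx.inner_smul (hJ i) hx)).sub ((hv i).inner_smul (hJ i) (hv i))).sub
      (.const_smul_sum_inner_smul 2 (Iio i) hv (hJ i))).add ((hv i).inner_smul hf hx)

theorem locallyLipschitz_saddleField (hF : ForceSplitting E Lin Non L) :
    LocallyLipschitz (saddleField (k := k) E) := by
  have hL := hF.pos
  have hf : LipschitzWith (2 * L).toNNReal (saddleForce E) :=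
    LipschitzWith.of_dist_le_mul fun a b => by
      rw [dist_eq_norm, dist_eq_norm, Real.coe_toNNReal _ (by positivity)]
      exact hF.saddleForce_lipschitz b a
  have hJ : LipschitzWith L.toNNReal (saddleJ E) :=
    LipschitzWith.of_dist_le_mul fun a b => by
      rw [dist_eq_norm, dist_eq_norm, Real.coe_toNNReal _ hL.le]
      exact hF.saddleJ_lipschitz b a
  have hfst : LocallyLipschitz (Prod.fst : Euc d × (Fin k → Euc d) → Euc d) :=
    LipschitzWith.prod_fst.locallyLipschitz
  have harg : LocallyLipschitz fun p : Euc d × (Fin k → Euc d) =>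
      (p, saddleForce E p.1, saddleJ E p.1) := by
    have h1 := hf.locallyLipschitz.comp hfst
    have h2 := hJ.locallyLipschitz.comp hfst
    have h3 := LocallyLipschitz.prodMk h1 h2
    exact LocallyLipschitz.prodMk LocallyLipschitz.id h3
  have e : saddleField (k := k) E =
      saddleFieldAux ∘ fun p => (p, saddleForce E p.1, saddleJ E p.1) := rfl
  have hΦ := (contDiff_saddleFieldAux (d := d) (k := k)).locallyLipschitz
  rw [e]
  exact hΦ.comp harg

/-- The saddle dynamics is the integral curve of `saddleField`. -/
theorem IsSaddleDynamics.hasDerivWithinAt {T : ℝ} {x₀ : Euc d} {v₀ : Fin k → Euc d}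
    {x : ℝ → Euc d} {v : Fin k → ℝ → Euc d} (h : IsSaddleDynamics E T x₀ v₀ x v) {t : ℝ}
    (ht : t ∈ Set.Icc 0 T) :
    HasDerivWithinAt (fun t => (x t, fun i => v i t)) (saddleField E (x t, fun i => v i t))
      (Set.Icc 0 T) t :=
  (h.x_deriv t ht).prodMk (hasDerivWithinAt_pi.2 fun i => h.v_deriv i t ht)

theorem IsSemiImplicitScheme.isSchemeStep {x₀ : Euc d} {v₀ : Fin k → Euc d} {τ : ℝ} {N : ℕ}
    {S : SchemeData d k} (h : IsSemiImplicitScheme E Lin Non x₀ v₀ τ N S) {n : ℕ} (hn : n < N) :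
    IsSchemeStep E Lin Non τ (S.x n) (S.v n) (S.xt (n + 1)) (S.x (n + 1)) (S.vt (n + 1))
      (S.vh (n + 1)) (S.v (n + 1)) :=
  ⟨h.x_step (n + 1) (by omega) hn, h.retraction (n + 1) (by omega) hn,
    h.v_step (n + 1) (by omega) hn, h.transport (n + 1) (by omega) hn,
    h.gram_schmidt (n + 1) (by omega) hn⟩

theorem SaddleInitialData.norm_le_one {x : Euc d} {v : Fin k → Euc d}
    (h : SaddleInitialData x v) : ‖(x, v)‖ ≤ 1 :=
  norm_prod_le_iff.2 ⟨h.norm_eq.le, (pi_norm_le_iff_of_nonneg zero_le_one).2 fun i =>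
    (h.orthonormal.1 i).le⟩

end VectorField

theorem theorem4p2 {d k : ℕ} (E : EuclideanSpace ℝ (Fin d) → ℝ) (hE : ContDiff ℝ 2 E)
    (Lin : EuclideanSpace ℝ (Fin d) →ₗ[ℝ] EuclideanSpace ℝ (Fin d))
    (Non : EuclideanSpace ℝ (Fin d) → EuclideanSpace ℝ (Fin d)) (L : ℝ)
    (hF : ForceSplitting E Lin Non L)
    (x₀ : EuclideanSpace ℝ (Fin d)) (v₀ : Fin k → EuclideanSpace ℝ (Fin d))
    (h₀ : SaddleInitialData x₀ v₀)
    (T : ℝ) (hT : 0 < T)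
    (x : ℝ → EuclideanSpace ℝ (Fin d)) (v : Fin k → ℝ → EuclideanSpace ℝ (Fin d))
    (hxv : IsSaddleDynamics E T x₀ v₀ x v) :
    ∃ τ₀ > (0 : ℝ), ∃ Q > (0 : ℝ), ∀ (N : ℕ) (τ : ℝ), 1 ≤ N → τ = T / N → τ ≤ τ₀ →
      (∃ S : SchemeData d k, IsSemiImplicitScheme E Lin Non x₀ v₀ τ N S) ∧
      ∀ S : SchemeData d k, IsSemiImplicitScheme E Lin Non x₀ v₀ τ N S →
        SchemeNondegenerate N S ∧
        ∀ n : ℕ, 1 ≤ n → n ≤ N →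
          ‖x (n * τ) - S.x n‖ ≤ Q * τ ∧ ∀ i, ‖v i (n * τ) - S.v n i‖ ≤ Q * τ := by
  obtain ⟨τ₁, hτ₁, hexist⟩ := exists_scheme hF h₀
  obtain ⟨τ₂, hτ₂, C, hC, hstep⟩ := exists_uniform_step k hE hF
  let u : ℝ → Euc d × (Fin k → Euc d) := fun t => (x t, fun i => v i t)
  have hd : ∀ t ∈ Set.Icc 0 T, HasDerivWithinAt u (saddleField E (u t)) (Set.Icc 0 T) t :=
    fun t ht => hxv.hasDerivWithinAt ht
  -- a ball that contains the exact solution and all the numerical iterates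
  obtain ⟨R, hR⟩ := isCompact_Icc.exists_bound_of_continuousOn
    fun t ht => (hd t ht).continuousWithinAt
  let s : Set (Euc d × (Fin k → Euc d)) := Metric.closedBall 0 (max R 1)
  have hs : IsCompact s := isCompact_closedBall _ _
  have hG := locallyLipschitz_saddleField (k := k) hF
  obtain ⟨K, hK⟩ := hG.locallyLipschitzOn.exists_lipschitzOnWith_of_compact hs
  obtain ⟨M, hM⟩ := hs.exists_bound_of_continuousOn hG.continuous.continuousOn
  have hM0 : 0 ≤ M := (norm_nonneg _).trans
    (hM 0 (Metric.mem_closedBall_self (zero_le_one.trans (le_max_right _ _))))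
  have hus : ∀ t ∈ Set.Icc 0 T, u t ∈ s := fun t ht =>
    mem_closedBall_zero_iff.2 ((hR t ht).trans (le_max_left _ _))
  refine ⟨min τ₁ τ₂, lt_min hτ₁ hτ₂, (C + K * M) * T * Real.exp (K * T), by positivity, ?_⟩
  intro N τ hN hτ hle
  have hN0 : (0 : ℝ) < N := by exact_mod_cast hN
  have hτ0 : 0 < τ := hτ ▸ div_pos hT hN0
  refine ⟨hexist τ hτ0 (hle.trans (min_le_left _ _)) N, fun S hS => ?_⟩
  have hstep' := fun n (hn : n < N) h =>
    hstep τ hτ0 (hle.trans (min_le_right _ _)) _ _ _ _ _ _ _ h (hS.isSchemeStep hn)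
  have hmanifold : ∀ n ≤ N, SaddleInitialData (S.x n) (S.v n) := by
    intro n
    induction n with
    | zero =>
      intro _
      rw [hS.x_init, hS.v_init]
      exact h₀
    | succ n ih => exact fun hn => (hstep' n hn (ih (by omega))).2.1
  have hloc := fun n (hn : n < N) => hstep' n hn (hmanifold n hn.le)
  refine ⟨fun n h1 hn => ?_, fun n _ hn => ?_⟩
  · obtain ⟨m, rfl⟩ : ∃ m, n = m + 1 := ⟨n - 1, by omega⟩
    exact (hloc m hn).1
  · have h := euler_convergence hK hM0 hC.le hus hM hd hτ0.le (N := N)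
      (by rw [hτ]; field_simp) (y := fun n => (S.x n, S.v n))
      (by simp only [u, hS.x_init, hS.v_init, hxv.x_init, hxv.v_init])
      (fun n hn => mem_closedBall_zero_iff.2
        ((hmanifold n hn).norm_le_one.trans (le_max_right _ _)))
      (fun n hn => norm_prod_le_iff.2 ⟨(hloc n hn).2.2.1,
        (pi_norm_le_iff_of_nonneg (by positivity)).2 (hloc n hn).2.2.2⟩) n hn
    obtain ⟨h1, h2⟩ := norm_prod_le_iff.1 h
    exact ⟨h1, fun i => (norm_le_pi_norm _ i).trans h2⟩
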